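/- Fix integers $r$ and $k_0\ge 1$ and a constant $\delta\in[0,1]$. For each sample size $n$ let $p=p_n$ be a dimension and let $$y_t=Ax_t+\varepsilon_t,\qquad t\in\mathbb Z,$$ be a factor model (which may depend on $n$), with $A$ a constant $p\times r$ matrix, $x_t$ an $r$-dimensional and $\varepsilon_t$ a $p$-dimensional process. Write $\Sigma_y(k)=\operatorname{cov}(y_{t+k},y_t)$, $\Sigma_x(k)=\operatorname{cov}(x_{t+k},x_t)$, $\Sigma_{x\varepsilon}(k)=\operatorname{cov}(x_{t+k},\varepsilon_t)$ and $$M=\sum_{k=1}^{k_0}\Sigma_y(k)\Sigma_y(k)',\qquad \hat M=\sum_{k=1}^{k_0}\hat\Sigma_y(k)\hat\Sigma_y(k)',\qquad \hat\Sigma_y(k)=\frac1n\sum_{t=1}^{n-k}(y_{t+k}-\bar y)(y_t-\bar y)',\quad \bar y=\frac1n\sum_{t=1}^n y_t,$$ with eigenvalues $\lambda_1\ge\dots\ge\lambda_p$ of $M$ and $\hat\lambda_1\ge\dots\ge\hat\lambda_p$ of $\hat M$. For a matrix $G$ let $\|G\|$ and $\|G\|_{\min}$ be the square roots of the largest and of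 the smallest nonzero eigenvalue of $GG'$. Assume: (C1) $\varepsilon_t$ is white noise (constant mean $\mu_\varepsilon$, constant covariance matrix $\Sigma_\varepsilon$, uncorrelated over time); if $c'x_t$ is white noise for a constant vector $c\in\mathbb R^r$, then $c'\operatorname{cov}(x_{t+k},\varepsilon_t)=0$ for all integers $k\ne0$; and $A'A=I_r$. (C2) $x_t$ is weakly stationary and $\operatorname{cov}(x_t,\varepsilon_{t+k})=0$ for all $k\ge0$. (C3) $y_t$ is strictly stationary and $\psi$-mixing with coefficients satisfying $\sum_{t\ge1}t\,\psi(t)^{1/2}<\infty$, and the components of $y_t$ have finite fourth moments; the bounds on this sum and on the fourth moments do not depend on $n$, $p$ or the component. Here $\psi(k)=\sup|P(A\cap B)/(P(A)P(B))-1|$ over events $A\in\sigma(y_s:s\le t)$ and $B\in\sigma(y_s:s\ge t+k)$ of positive probability. (C4) $\lambda_1>\dots>\lambda_r>0=\lambda_{r+1}=\dots=\lambda_p$. (C5) $\|\Sigma_x(k)\|\asymp p^{1-\delta}\asymp\|\Sigma_x(k)\|_{\min}$ for $k=1,\dots,k_0$. (C6) $\|\Sigma_{x\varepsilon}(k)\|=o(p^{1-\delta})$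 for $k=0,1,\dots,k_0$. Suppose $n\to\infty$, $p=p_n\to\infty$ (with $r$, $k_0$, $\delta$ fixed) and $h_n=p^{\delta}n^{-1/2}\to0$. Then (i) $|\hat\lambda_i-\lambda_i|=O_P(p^{2-\delta}n^{-1/2})$ for $i=1,\dots,r$; (ii) $\hat\lambda_j=O_P(p^2n^{-1})$ for $j=r+1,\dots,p$, uniformly in $j$. In particular $p^2n^{-1}=o(p^{2-\delta}n^{-1/2})$, so the rate in (ii) for the zero eigenvalues is of smaller order than the rate in (i) for the nonzero ones. -/

import Mathlib

open MeasureTheory ProbabilityTheory Filter Topology Asymptotics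
open scoped ENNReal NNReal Matrix
-- `‖G‖` for a real matrix is the spectral norm, the square root of the largest eigenvalue of `G Gᵀ`.
open scoped Matrix.Norms.L2Operator

namespace FactorSeries

noncomputable section

/-! ### Second-order notions for vector-valued random variables and processes -/

/-- The matrix `cov(X, Y)` with entries `cov(X_i, Y_j)`. -/
def crossCov {Ω ι κ : Type*} [MeasurableSpace Ω] (P : Measure Ω)
    (X : Ω → ι → ℝ) (Y : Ω → κ → ℝ) : Matrix ι κ ℝ :=
  Matrix.of fun i j => covariance (fun ω => X ω i) (fun ω => Y ω j) P

/-- `e_t ∼ WN(m, S)`: constant mean `m`, constant variance matrix `S`, and no correlation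
between different times. -/
structure IsWhiteNoise {Ω ι : Type*} [MeasurableSpace Ω] (P : Measure Ω)
    (e : ℤ → Ω → ι → ℝ) (m : ι → ℝ) (S : Matrix ι ι ℝ) : Prop where
  memLp : ∀ t i, MemLp (fun ω => e t ω i) 2 P
  mean_eq : ∀ t i, ∫ ω, e t ω i ∂P = m i
  cov_eq : ∀ t, crossCov P (e t) (e t) = S
  uncorrelated : ∀ s t, s ≠ t → crossCov P (e s) (e t) = 0

/-- Weak (second-order) stationarity. -/
structure IsWeaklyStationary {Ω ι : Type*} [MeasurableSpace Ω] (P : Measure Ω)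
    (x : ℤ → Ω → ι → ℝ) : Prop where
  memLp : ∀ t i, MemLp (fun ω => x t ω i) 2 P
  mean_eq : ∀ s t i, ∫ ω, x s ω i ∂P = ∫ ω, x t ω i ∂P
  cov_eq : ∀ s t k, crossCov P (x (s + k)) (x s) = crossCov P (x (t + k)) (x t)

/-- Strict stationarity: the law of the whole path is invariant under time shifts. -/
def IsStrictlyStationary {Ω ι : Type*} [MeasurableSpace Ω] (P : Measure Ω)
    (y : ℤ → Ω → ι → ℝ) : Prop :=
  ∀ h : ℤ, P.map (fun ω t => y (t + h) ω) = P.map (fun ω t => y t ω)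

/-- The σ-algebra generated by `y_s`, `s ≤ t`. -/
@[reducible] def pastSigma {Ω ι : Type*} (y : ℤ → Ω → ι → ℝ) (t : ℤ) : MeasurableSpace Ω :=
  ⨆ s : Set.Iic t, MeasurableSpace.comap (y s) inferInstance

/-- The σ-algebra generated by `y_s`, `s ≥ t`. -/
@[reducible] def futureSigma {Ω ι : Type*} (y : ℤ → Ω → ι → ℝ) (t : ℤ) : MeasurableSpace Ω :=
  ⨆ s : Set.Ici t, MeasurableSpace.comap (y s) inferInstance

/-- The `ψ`-mixing coefficient `ψ(k) = sup |P(A ∩ B) / (P(A) P(B)) - 1|`, over events `A` of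
positive probability up to time `t` and `B` of positive probability from time `t + k` on
(and over `t`, on which the supremum does not depend if the process is strictly stationary). -/
def psiCoeff {Ω ι : Type*} [MeasurableSpace Ω] (P : Measure Ω)
    (y : ℤ → Ω → ι → ℝ) (k : ℕ) : ℝ≥0∞ :=
  ⨆ (t : ℤ) (A : Set Ω) (B : Set Ω) (_ : MeasurableSet[pastSigma y t] A)
    (_ : MeasurableSet[futureSigma y (t + k)] B) (_ : P A ≠ 0) (_ : P B ≠ 0),
    ENNReal.ofReal |P.real (A ∩ B) / (P.real A * P.real B) - 1|

/-! ### Matrices -/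

/-- `‖G‖_min`, the square root of the smallest nonzero eigenvalue of `G Gᵀ`. -/
def minNorm {m n : ℕ} (G : Matrix (Fin m) (Fin n) ℝ) : ℝ :=
  Real.sqrt (sInf {l : ℝ | l ≠ 0 ∧ Module.End.HasEigenvalue (Matrix.toLin' (G * Gᵀ)) l})

/-- The eigenvalues of a symmetric matrix in descending order, with multiplicity, counted from
`0`: index `j < p` gives the `(j + 1)`-th largest one (and `0` for `j ≥ p`). -/
def sortedEig {p : ℕ} {M : Matrix (Fin p) (Fin p) ℝ} (hM : M.IsHermitian) (j : ℕ) : ℝ :=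
  if h : j < p then hM.eigenvalues₀ ⟨j, by simpa using h⟩ else 0

/-- `∑_{k=1}^{k₀} S(k) S(k)ᵀ`. -/
def lagSum {p : ℕ} (S : ℕ → Matrix (Fin p) (Fin p) ℝ) (k₀ : ℕ) : Matrix (Fin p) (Fin p) ℝ :=
  ∑ k ∈ Finset.Icc 1 k₀, S k * (S k)ᵀ

theorem lagSum_isHermitian {p : ℕ} (S : ℕ → Matrix (Fin p) (Fin p) ℝ) (k₀ : ℕ) :
    (lagSum S k₀).IsHermitian := by
  unfold lagSum Matrix.IsHermitian
  rw [Matrix.conjTranspose_sum]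
  refine Finset.sum_congr rfl fun k _ => ?_
  simp [Matrix.conjTranspose_eq_transpose_of_trivial]

/-! ### The factor model -/

/-- The data of `y_t = A x_t + ε_t`, `t ∈ ℤ`: a `p × r` loading matrix `A`, an `r`-dimensional
factor process `x` and a `p`-dimensional noise process `ε`. -/
structure FactorModel (Ω : Type*) [MeasurableSpace Ω] (r p : ℕ) where
  A : Matrix (Fin p) (Fin r) ℝ
  x : ℤ → Ω → Fin r → ℝ
  ε : ℤ → Ω → Fin p → ℝ
  measurable_x : ∀ t, Measurable (x t)
  measurable_ε : ∀ t, Measurable (ε t)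

namespace FactorModel

variable {Ω : Type*} [MeasurableSpace Ω] {r p : ℕ}

/-- The observed process `y_t = A x_t + ε_t`. -/
def y (F : FactorModel Ω r p) (t : ℤ) (ω : Ω) : Fin p → ℝ :=
  F.A *ᵥ F.x t ω + F.ε t ω

/-- `Σ_x(k) = cov(x_{t+k}, x_t)`, taken at `t = 0`. -/
def covX (F : FactorModel Ω r p) (P : Measure Ω) (k : ℕ) : Matrix (Fin r) (Fin r) ℝ :=
  crossCov P (F.x k) (F.x 0)

/-- `Σ_{xε}(k) = cov(x_{t+k}, ε_t)`, taken at `t = 0` (under the model assumptions below it does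
not depend on `t`, because `A` is injective and the autocovariances of `x` and `y` do not). -/
def covXNoise (F : FactorModel Ω r p) (P : Measure Ω) (k : ℕ) : Matrix (Fin r) (Fin p) ℝ :=
  crossCov P (F.x k) (F.ε 0)

/-- `Σ_y(k) = cov(y_{t+k}, y_t)`, taken at `t = 0`. -/
def covY (F : FactorModel Ω r p) (P : Measure Ω) (k : ℕ) : Matrix (Fin p) (Fin p) ℝ :=
  crossCov P (F.y k) (F.y 0)

/-- The sample mean of `y_1, …, y_n`. -/
def sampleMean (F : FactorModel Ω r p) (n : ℕ) (ω : Ω) : Fin p → ℝ :=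
  (n : ℝ)⁻¹ • ∑ t ∈ Finset.Icc 1 n, F.y t ω

/-- The sample lag-`k` autocovariance matrix
`n⁻¹ ∑_{t=1}^{n-k} (y_{t+k} - ȳ) (y_t - ȳ)ᵀ` of `y_1, …, y_n`. -/
def sampleCovY (F : FactorModel Ω r p) (n : ℕ) (ω : Ω) (k : ℕ) : Matrix (Fin p) (Fin p) ℝ :=
  (n : ℝ)⁻¹ • ∑ t ∈ Finset.Icc 1 (n - k),
    Matrix.vecMulVec (F.y ((t : ℤ) + k) ω - F.sampleMean n ω) (F.y t ω - F.sampleMean n ω)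

/-- The eigenvalues, in descending order, of `M = ∑_{k=1}^{k₀} Σ_y(k) Σ_y(k)ᵀ`. -/
def eig (F : FactorModel Ω r p) (P : Measure Ω) (k₀ : ℕ) (j : ℕ) : ℝ :=
  sortedEig (lagSum_isHermitian (F.covY P) k₀) j

/-- The eigenvalues, in descending order, of the sample version of `M` built from
`y_1, …, y_n`. -/
def eigHat (F : FactorModel Ω r p) (k₀ n : ℕ) (j : ℕ) (ω : Ω) : ℝ :=
  sortedEig (lagSum_isHermitian (F.sampleCovY n ω) k₀) j

/-- `ε` is white noise; if `cᵀ x_t` is white noise for a constant vector `c` then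
`cᵀ cov(x_{t+k}, ε_t) = 0` for all `k ≠ 0`; and `Aᵀ A = I_r`. -/
structure IsIdentified (F : FactorModel Ω r p) (P : Measure Ω) : Prop where
  noise : ∃ m S, IsWhiteNoise P F.ε m S
  whiteComb : ∀ c : Fin r → ℝ,
    (∃ m S, IsWhiteNoise P (fun t ω (_ : Unit) => c ⬝ᵥ F.x t ω) m S) →
      ∀ t k : ℤ, k ≠ 0 → c ᵥ* crossCov P (F.x (t + k)) (F.ε t) = 0
  orthonormal : F.Aᵀ * F.A = 1

/-- `x` is weakly stationary and `cov(x_t, ε_{t+k}) = 0` for all `k ≥ 0`. -/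
structure FutureNoiseUncorrelated (F : FactorModel Ω r p) (P : Measure Ω) : Prop where
  stationary : IsWeaklyStationary P F.x
  uncorrelated : ∀ (t : ℤ) (k : ℕ), crossCov P (F.x t) (F.ε (t + k)) = 0

/-- `λ_1 > ⋯ > λ_r > 0 = λ_{r+1} = ⋯ = λ_p`. -/
structure DistinctEig (F : FactorModel Ω r p) (P : Measure Ω) (k₀ : ℕ) : Prop where
  strict : ∀ i j, i < j → j < r → F.eig P k₀ j < F.eig P k₀ i
  pos : ∀ i, i < r → 0 < F.eig P k₀ i
  zero : ∀ j, r ≤ j → j < p → F.eig P k₀ j = 0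

end FactorModel

/-! ### Sequences of models, of dimensions `p n → ∞` -/

section Sequences

variable {Ω : ℕ → Type*} [∀ n, MeasurableSpace (Ω n)] {r : ℕ} {p : ℕ → ℕ}

/-- `y` is strictly stationary and `ψ`-mixing with `∑_{t ≥ 1} t ψ(t)^{1/2} < ∞`, and its
components have finite fourth moments, with bounds that do not depend on the dimension. -/
structure MixingMoments (P : ∀ n, Measure (Ω n)) (F : ∀ n, FactorModel (Ω n) r (p n)) :
    Prop where
  stationary : ∀ n, IsStrictlyStationary (P n) (F n).y
  mixing : ∃ C : ℝ≥0, ∀ n,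
    ∑' t : ℕ, (t : ℝ≥0∞) * psiCoeff (P n) (F n).y t ^ (1 / 2 : ℝ) ≤ C
  moments : ∃ C : ℝ≥0, ∀ n (t : ℤ) (i : Fin (p n)),
    ∫⁻ ω, ‖(F n).y t ω i‖ₑ ^ 4 ∂(P n) ≤ C

/-- `‖Σ_x(k)‖ ≍ p^{1-δ} ≍ ‖Σ_x(k)‖_min` for `k = 1, …, k₀`. -/
def FactorStrength (P : ∀ n, Measure (Ω n)) (F : ∀ n, FactorModel (Ω n) r (p n))
    (k₀ : ℕ) (δ : ℝ) : Prop :=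
  ∀ k ∈ Finset.Icc 1 k₀,
    (fun n => ‖(F n).covX (P n) k‖) =Θ[atTop] (fun n => (p n : ℝ) ^ (1 - δ)) ∧
    (fun n => minNorm ((F n).covX (P n) k)) =Θ[atTop] (fun n => (p n : ℝ) ^ (1 - δ))

/-- `‖Σ_{xε}(k)‖ = o(p^{1-δ})` for `k = 0, 1, …, k₀`. -/
def WeakCrossCov (P : ∀ n, Measure (Ω n)) (F : ∀ n, FactorModel (Ω n) r (p n))
    (k₀ : ℕ) (δ : ℝ) : Prop :=
  ∀ k ∈ Finset.range (k₀ + 1),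
    (fun n => ‖(F n).covXNoise (P n) k‖) =o[atTop] (fun n => (p n : ℝ) ^ (1 - δ))

/-- `X_n = O_P(a_n)`. -/
def IsBigOP (P : ∀ n, Measure (Ω n)) (X : ∀ n, Ω n → ℝ) (a : ℕ → ℝ) : Prop :=
  ∀ η : ℝ, 0 < η → ∃ C : ℝ, 0 < C ∧
    ∀ᶠ n in atTop, P n {ω | C * a n < |X n ω|} ≤ ENNReal.ofReal η

/-- `X_{n,j} = O_P(a_n)` uniformly over the indices `j ∈ J n`. -/
def IsBigOPUniform (P : ∀ n, Measure (Ω n)) (J : ℕ → Set ℕ) (X : ∀ n, ℕ → Ω n → ℝ)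
    (a : ℕ → ℝ) : Prop :=
  ∀ η : ℝ, 0 < η → ∃ C : ℝ, 0 < C ∧
    ∀ᶠ n in atTop, P n {ω | ∃ j ∈ J n, C * a n < |X n j ω|} ≤ ENNReal.ofReal η

end Sequences

end

end FactorSeries

/-!
The eigenvalues of `M̂` and `M` are compared through the errors `Δ_k = Σ̂_y(k) - Σ_y(k)`, all of
which have spectral norm `O_P(p n^{-1/2})`.

*Size of the errors.* For nonnegative functions `U` of the past and `V` of the future,
`ψ`-mixing says that `E[UV]` lies between `(1 - ψ) E[U] E[V]` and `(1 + ψ) E[U] E[V]`: on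
indicators this is the definition, and it passes to functions because both sides are measures in
each argument (`lintegral_mul_lintegral_le_of_forall_measurableSet`). Hence
`|cov(U, V)| ≤ ψ E|U| E|V|`, and sums of `N` terms depending on finitely many consecutive
observations have variance `O(N)` (`variance_sum_le`). Applied to the components of the centred
process `z` and to the products `z_{t+k,i} z_{t,j}`, which are square integrable by the fourth
moment assumption, this bounds the Frobenius norm of `Δ_k`: the `p²` entries of the sum of
products contribute `p² / n` to the mean of the square, while centring at the sample mean
contributes rank-one matrices, whose norms are products of two vector norms of order
`(p / n)^{1/2}` (`exists_norm_sampleCovY_sub_sq_le`).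

*Nonzero eigenvalues.* Since the noise is uncorrelated with its past and with the past of the
factors, `Σ_y(k) = A (Σ_x(k) Aᵀ + Σ_{xε}(k))` for `k ≥ 1`, so `‖Σ_y(k)‖ = O(p^{1-δ})`. By Weyl's
inequality the eigenvalues move by at most `‖M̂ - M‖ ≤ ∑ (2 ‖Σ_y(k)‖ ‖Δ_k‖ + ‖Δ_k‖²)`, which is
`O_P(p^{2-δ} n^{-1/2} + p² n⁻¹)`, and the second term is the first one times
`p^δ n^{-1/2} → 0`.

*Zero eigenvalues.* On the kernel of `Aᵀ`, of codimension at most `r`, all `Σ_y(k)ᵀ` vanish, so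
the quadratic form of `M̂` is `∑ ‖Δ_kᵀ v‖²` there. By the Courant–Fischer principle
(`eigenvalues_le_of_forall_mem`) every eigenvalue of `M̂` after the `r`-th is at most
`∑ ‖Δ_k‖² = O_P(p² n⁻¹)` (`sortedEig_lagSum_le_of_range`). Being quadratic in the errors, this
bound needs no estimate of eigenvectors or spectral gaps.
-/

namespace FactorSeries

/-! ### Eigenvalues of symmetric operators -/

section Eigenvalues

variable {E : Type*} [NormedAddCommGroup E] [InnerProductSpace ℝ E] {m : ℕ}

theorem inner_eq_zero_of_mem_span_image (b : OrthonormalBasis (Fin m) ℝ E) {s : Finset (Fin m)}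
    {x : E} (hx : x ∈ Submodule.span ℝ (b '' (s : Set (Fin m)))) {i : Fin m} (hi : i ∉ s) :
    inner ℝ (b i) x = 0 := by
  induction hx using Submodule.span_induction with
  | mem x h =>
    obtain ⟨j, hj, rfl⟩ := h
    have hij : i ≠ j := fun h => hi (h ▸ hj)
    exact b.orthonormal.2 hij
  | zero => simp
  | add x y _ _ hx hy => rw [inner_add_right, hx, hy, add_zero]
  | smul a x _ hx => rw [inner_smul_right, hx, mul_zero]

theorem finrank_span_image_orthonormalBasis (b : OrthonormalBasis (Fin m) ℝ E)
    (s : Finset (Fin m)) :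
    Module.finrank ℝ (Submodule.span ℝ (b '' (s : Set (Fin m)))) = s.card := by
  have hli : LinearIndependent ℝ (fun i : s => b i) :=
    b.orthonormal.linearIndependent.comp _ Subtype.val_injective
  have h := finrank_span_eq_card hli
  have hr : Set.range (fun i : s => b i) = b '' (s : Set (Fin m)) := by
    ext x; simp
  rw [hr] at h
  simpa using h

theorem norm_sq_eq_sum_inner_sq (b : OrthonormalBasis (Fin m) ℝ E) (x : E) :
    ‖x‖ ^ 2 = ∑ i, inner ℝ (b i) x ^ 2 := by
  rw [← real_inner_self_eq_norm_sq, ← b.sum_inner_mul_inner x x]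
  refine Finset.sum_congr rfl fun i _ => ?_
  rw [real_inner_comm x, sq]

variable [FiniteDimensional ℝ E]

theorem inner_apply_self_eq_sum {T : E →ₗ[ℝ] E} (hT : T.IsSymmetric)
    (hm : Module.finrank ℝ E = m) (x : E) :
    inner ℝ (T x) x =
      ∑ i, hT.eigenvalues hm i * inner ℝ (hT.eigenvectorBasis hm i) x ^ 2 := by
  rw [← (hT.eigenvectorBasis hm).sum_inner_mul_inner (T x) x]
  refine Finset.sum_congr rfl fun i _ => ?_
  rw [hT x, hT.apply_eigenvectorBasis, inner_smul_right, real_inner_comm x]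
  simp only [RCLike.ofReal_real_eq_id, id]
  ring

/-- One half of the Courant–Fischer principle: a bound for the quadratic form on a subspace of
codimension at most `j` bounds the eigenvalue with index `j` (counted from `0`, in descending
order), because the span of the first `j + 1` eigenvectors meets that subspace. -/
theorem eigenvalues_le_of_forall_mem {T : E →ₗ[ℝ] E} (hT : T.IsSymmetric)
    (hm : Module.finrank ℝ E = m) (j : Fin m) (V : Submodule ℝ E)
    (hV : m ≤ Module.finrank ℝ V + j) {c : ℝ}
    (hc : ∀ x ∈ V, inner ℝ (T x) x ≤ c * ‖x‖ ^ 2) : hT.eigenvalues hm j ≤ c := by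
  set b := hT.eigenvectorBasis hm with hb
  set W := Submodule.span ℝ (b '' ((Finset.Iic j : Finset (Fin m)) : Set (Fin m))) with hW
  have hWdim : Module.finrank ℝ W = j + 1 := by
    rw [hW, finrank_span_image_orthonormalBasis, Fin.card_Iic]
  have hdim := Submodule.finrank_sup_add_finrank_inf_eq V W
  have hle := Submodule.finrank_le (V ⊔ W)
  have hpos : 0 < Module.finrank ℝ ↥(V ⊓ W) := by omega
  obtain ⟨⟨x, hx⟩, hx0⟩ := (Module.finrank_pos_iff_exists_ne_zero (R := ℝ)).1 hpos
  have hx0' : x ≠ 0 := fun h => hx0 (by ext; exact h)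
  obtain ⟨hxV, hxW⟩ := Submodule.mem_inf.1 hx
  have h1 := hc x hxV
  have h2 : hT.eigenvalues hm j * ‖x‖ ^ 2 ≤ inner ℝ (T x) x := by
    rw [inner_apply_self_eq_sum hT hm, norm_sq_eq_sum_inner_sq b, Finset.mul_sum]
    refine Finset.sum_le_sum fun i _ => ?_
    by_cases hi : i ≤ j
    · exact mul_le_mul_of_nonneg_right (hT.eigenvalues_antitone hm hi) (sq_nonneg _)
    · rw [inner_eq_zero_of_mem_span_image b hxW (by simpa using hi)]
      simp
  have hn : 0 < ‖x‖ ^ 2 := by positivity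
  exact le_of_mul_le_mul_right (h2.trans h1) hn

/-- One side of **Weyl's inequality**. -/
theorem eigenvalues_le_add_of_form_le {S T : E →ₗ[ℝ] E} (hS : S.IsSymmetric)
    (hT : T.IsSymmetric) (hm : Module.finrank ℝ E = m) (j : Fin m) {d : ℝ}
    (hd : ∀ x, inner ℝ (S x) x ≤ inner ℝ (T x) x + d * ‖x‖ ^ 2) :
    hS.eigenvalues hm j ≤ hT.eigenvalues hm j + d := by
  set b := hT.eigenvectorBasis hm with hb
  refine eigenvalues_le_of_forall_mem hS hm j
    (Submodule.span ℝ (b '' ((Finset.Ici j : Finset (Fin m)) : Set (Fin m)))) ?_ ?_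
  · rw [finrank_span_image_orthonormalBasis, Fin.card_Ici]; omega
  · intro x hx
    refine (hd x).trans ?_
    rw [add_mul]
    refine add_le_add_left ?_ _
    rw [inner_apply_self_eq_sum hT hm, norm_sq_eq_sum_inner_sq b, Finset.mul_sum]
    refine Finset.sum_le_sum fun i _ => ?_
    by_cases hi : j ≤ i
    · exact mul_le_mul_of_nonneg_right (hT.eigenvalues_antitone hm hi) (sq_nonneg _)
    · simp [← hb, inner_eq_zero_of_mem_span_image b hx (i := i) (by simpa using hi)]

end Eigenvalues

section SortedEigenvalues

variable {p : ℕ}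

theorem inner_toEuclideanLin_le (M : Matrix (Fin p) (Fin p) ℝ) (x : EuclideanSpace ℝ (Fin p)) :
    inner ℝ (Matrix.toEuclideanLin M x) x ≤ ‖M‖ * ‖x‖ ^ 2 := by
  refine (real_inner_le_norm _ _).trans ?_
  rw [sq, ← mul_assoc]
  exact mul_le_mul_of_nonneg_right (Matrix.l2_opNorm_mulVec M x) (norm_nonneg _)

theorem sortedEig_le_add_norm_sub {M N : Matrix (Fin p) (Fin p) ℝ} (hM : M.IsHermitian)
    (hN : N.IsHermitian) (j : ℕ) : sortedEig hM j ≤ sortedEig hN j + ‖M - N‖ := by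
  unfold sortedEig
  split_ifs with h
  · refine eigenvalues_le_add_of_form_le _ _ _ _ fun x => ?_
    have := inner_toEuclideanLin_le (M - N) x
    rw [map_sub, LinearMap.sub_apply, inner_sub_left] at this
    linarith
  · simp

/-- **Weyl's inequality** for the sorted eigenvalues of symmetric matrices. -/
theorem abs_sortedEig_sub_le {M N : Matrix (Fin p) (Fin p) ℝ} (hM : M.IsHermitian)
    (hN : N.IsHermitian) (j : ℕ) : |sortedEig hM j - sortedEig hN j| ≤ ‖M - N‖ := by
  have h1 := sortedEig_le_add_norm_sub hM hN j
  have h2 := sortedEig_le_add_norm_sub hN hM j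
  rw [norm_sub_rev] at h2
  exact abs_le.2 ⟨by linarith, by linarith⟩

/-- If the quadratic form of `M` is at most `c ‖x‖²` on the kernel of `Bᵀ`, where `B` has `r`
columns, then all but the `r` largest eigenvalues of `M` are at most `c`. -/
theorem sortedEig_le_of_ker {r : ℕ} {M : Matrix (Fin p) (Fin p) ℝ} (hM : M.IsHermitian)
    (B : Matrix (Fin p) (Fin r) ℝ) {c : ℝ} (hc0 : 0 ≤ c)
    (hc : ∀ x : EuclideanSpace ℝ (Fin p), Matrix.toEuclideanLin Bᵀ x = 0 →
      inner ℝ (Matrix.toEuclideanLin M x) x ≤ c * ‖x‖ ^ 2) {j : ℕ} (hj : r ≤ j) :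
    sortedEig hM j ≤ c := by
  unfold sortedEig
  split_ifs with h
  · refine eigenvalues_le_of_forall_mem _ _ _ (LinearMap.ker (Matrix.toEuclideanLin Bᵀ)) ?_
      fun x hx => hc x hx
    have h1 := (Matrix.toEuclideanLin Bᵀ).finrank_range_add_finrank_ker
    have h2 := Submodule.finrank_le (LinearMap.range (Matrix.toEuclideanLin Bᵀ))
    simp only [finrank_euclideanSpace, Fintype.card_fin] at h1 h2 ⊢
    omega
  · exact hc0

theorem sortedEig_nonneg {M : Matrix (Fin p) (Fin p) ℝ} (hM : M.PosSemidef) (j : ℕ) :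
    0 ≤ sortedEig hM.isHermitian j := by
  unfold sortedEig
  split_ifs with h
  · have := hM.eigenvalues_nonneg
      (Fintype.equivOfCardEq (Fintype.card_fin _) ⟨j, by simpa using h⟩)
    simpa [Matrix.IsHermitian.eigenvalues] using this
  · exact le_rfl

end SortedEigenvalues

/-! ### Sums of `S(k) S(k)ᵀ` -/

section LagSum

variable {p : ℕ}

theorem norm_transpose_eq {m n : ℕ} (G : Matrix (Fin m) (Fin n) ℝ) : ‖Gᵀ‖ = ‖G‖ := by
  rw [← Matrix.conjTranspose_eq_transpose_of_trivial, Matrix.l2_opNorm_conjTranspose]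

/-- The spectral norm is at most the Frobenius norm. -/
theorem norm_sq_le_sum_sq {m n : ℕ} (G : Matrix (Fin m) (Fin n) ℝ) :
    ‖G‖ ^ 2 ≤ ∑ i, ∑ j, G i j ^ 2 := by
  have h0 : 0 ≤ ∑ i, ∑ j, G i j ^ 2 :=
    Finset.sum_nonneg fun i _ => Finset.sum_nonneg fun j _ => sq_nonneg _
  refine (Real.le_sqrt (norm_nonneg _) h0).1 ?_
  rw [Matrix.l2_opNorm_def]
  refine ContinuousLinearMap.opNorm_le_bound _ (Real.sqrt_nonneg _) fun x => ?_
  rw [← abs_of_nonneg (norm_nonneg x), ← Real.sqrt_sq_eq_abs, ← Real.sqrt_mul h0]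
  refine Real.le_sqrt_of_sq_le ?_
  rw [EuclideanSpace.real_norm_sq_eq, EuclideanSpace.real_norm_sq_eq, Finset.sum_mul]
  refine Finset.sum_le_sum fun i _ => ?_
  exact Finset.sum_mul_sq_le_sq_mul_sq Finset.univ (G i) x.ofLp

theorem lagSum_posSemidef (S : ℕ → Matrix (Fin p) (Fin p) ℝ) (k₀ : ℕ) :
    (lagSum S k₀).PosSemidef := by
  unfold lagSum
  refine Matrix.posSemidef_sum _ fun k _ => ?_
  simpa [Matrix.conjTranspose_eq_transpose_of_trivial] using
    Matrix.posSemidef_self_mul_conjTranspose (S k)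

theorem norm_lagSum_sub_le (S T : ℕ → Matrix (Fin p) (Fin p) ℝ) (k₀ : ℕ) :
    ‖lagSum T k₀ - lagSum S k₀‖ ≤
      ∑ k ∈ Finset.Icc 1 k₀, (2 * ‖S k‖ * ‖T k - S k‖ + ‖T k - S k‖ ^ 2) := by
  unfold lagSum
  rw [← Finset.sum_sub_distrib]
  refine (norm_sum_le _ _).trans (Finset.sum_le_sum fun k _ => ?_)
  have h : T k * (T k)ᵀ - S k * (S k)ᵀ =
      S k * (T k - S k)ᵀ + (T k - S k) * (S k)ᵀ + (T k - S k) * (T k - S k)ᵀ := by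
    rw [Matrix.transpose_sub]; noncomm_ring
  rw [h]
  refine (norm_add₃_le).trans ?_
  have h1 := Matrix.l2_opNorm_mul (S k) (T k - S k)ᵀ
  have h2 := Matrix.l2_opNorm_mul (T k - S k) (S k)ᵀ
  have h3 := Matrix.l2_opNorm_mul (T k - S k) (T k - S k)ᵀ
  rw [norm_transpose_eq] at h1 h2 h3
  nlinarith

theorem inner_lagSum (S : ℕ → Matrix (Fin p) (Fin p) ℝ) (k₀ : ℕ)
    (x : EuclideanSpace ℝ (Fin p)) :
    inner ℝ (Matrix.toEuclideanLin (lagSum S k₀) x) x =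
      ∑ k ∈ Finset.Icc 1 k₀, ‖Matrix.toEuclideanLin (S k)ᵀ x‖ ^ 2 := by
  unfold lagSum
  rw [map_sum, LinearMap.sum_apply, sum_inner]
  refine Finset.sum_congr rfl fun k _ => ?_
  rw [EuclideanSpace.real_norm_sq_eq, EuclideanSpace.inner_eq_star_dotProduct]
  simp only [star_trivial, Matrix.ofLp_toLpLin, Matrix.toLin'_apply]
  rw [← Matrix.mulVec_mulVec, Matrix.dotProduct_mulVec, ← Matrix.mulVec_transpose]
  simp [dotProduct, sq]

/-- If the columns of each `S k` lie in the range of `B`, which has `r` columns, then `(T k)ᵀ`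
and `(T k - S k)ᵀ` agree on the kernel of `Bᵀ`, so that all but the `r` largest eigenvalues of
`∑ T(k) T(k)ᵀ` are quadratic in the error `T - S`. -/
theorem sortedEig_lagSum_le_of_range {r : ℕ} (S T : ℕ → Matrix (Fin p) (Fin p) ℝ) (k₀ : ℕ)
    (B : Matrix (Fin p) (Fin r) ℝ)
    (hB : ∀ k ∈ Finset.Icc 1 k₀, ∃ G : Matrix (Fin r) (Fin p) ℝ, S k = B * G)
    {j : ℕ} (hj : r ≤ j) :
    sortedEig (lagSum_isHermitian T k₀) j ≤ ∑ k ∈ Finset.Icc 1 k₀, ‖T k - S k‖ ^ 2 := by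
  refine sortedEig_le_of_ker _ B (Finset.sum_nonneg fun _ _ => sq_nonneg _) (fun x hx => ?_) hj
  rw [inner_lagSum, Finset.sum_mul]
  refine Finset.sum_le_sum fun k hk => ?_
  obtain ⟨G, hG⟩ := hB k hk
  have hS : Matrix.toEuclideanLin (S k)ᵀ x = 0 := by
    have hx' : Bᵀ *ᵥ x.ofLp = 0 := by
      simpa [Matrix.toLpLin_apply] using hx
    rw [hG, Matrix.transpose_mul, Matrix.toLpLin_apply, ← Matrix.mulVec_mulVec, hx']
    simp
  have hT : Matrix.toEuclideanLin (T k)ᵀ x = Matrix.toEuclideanLin (T k - S k)ᵀ x := by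
    rw [Matrix.transpose_sub, map_sub, LinearMap.sub_apply, hS, sub_zero]
  rw [hT, ← mul_pow, ← norm_transpose_eq (T k - S k)]
  exact pow_le_pow_left₀ (norm_nonneg _) (Matrix.l2_opNorm_mulVec _ x) 2

end LagSum

/-! ### Covariance inequalities under `ψ`-mixing -/

/-- The σ-algebras `m₁` and `m₂` are `ψ`-mixing with coefficient at most `c`. The bound on
`|P(A ∩ B) / (P(A) P(B)) - 1|` is multiplied out, so that null events need not be excluded. -/
def IsPsiMixing {Ω : Type*} (m₁ m₂ : MeasurableSpace Ω) [MeasurableSpace Ω] (P : Measure Ω) (c : ℝ) :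
    Prop :=
  ∀ A B, MeasurableSet[m₁] A → MeasurableSet[m₂] B →
    |P.real (A ∩ B) - P.real A * P.real B| ≤ c * (P.real A * P.real B)

theorem measurable_pastSigma {Ω ι : Type*} (y : ℤ → Ω → ι → ℝ) {s t : ℤ} (hst : s ≤ t) (i : ι) :
    Measurable[pastSigma y t] fun ω => y s ω i := by
  have h : Measurable[pastSigma y t] (y s) :=
    (comap_measurable (y s)).mono
      (le_iSup (fun s : Set.Iic t => MeasurableSpace.comap (y s) inferInstance) ⟨s, hst⟩) le_rfl
  exact (measurable_pi_apply i).comp h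

theorem measurable_futureSigma {Ω ι : Type*} (y : ℤ → Ω → ι → ℝ) {s t : ℤ} (hst : t ≤ s) (i : ι) :
    Measurable[futureSigma y t] fun ω => y s ω i := by
  have h : Measurable[futureSigma y t] (y s) :=
    (comap_measurable (y s)).mono
      (le_iSup (fun s : Set.Ici t => MeasurableSpace.comap (y s) inferInstance) ⟨s, hst⟩) le_rfl
  exact (measurable_pi_apply i).comp h

section Mixing

variable {Ω : Type*} {m₁ m₂ : MeasurableSpace Ω} [m0 : MeasurableSpace Ω] {P : Measure Ω}

/-- A linear inequality between `P A * P B` and `P (A ∩ B)`, valid for all events of two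
σ-algebras, passes to nonnegative functions measurable with respect to them: for fixed `B` both
sides are measures in `A`, and for a fixed function in place of `A` both are measures in `B`. -/
theorem lintegral_mul_lintegral_le_of_forall_measurableSet [IsProbabilityMeasure P]
    (h₁ : m₁ ≤ m0) (h₂ : m₂ ≤ m0) {a b a' b' : ℝ≥0∞}
    (h : ∀ A B, MeasurableSet[m₁] A → MeasurableSet[m₂] B →
      a * (P A * P B) + b * P (A ∩ B) ≤ a' * (P A * P B) + b' * P (A ∩ B))
    {U V : Ω → ℝ≥0∞} (hU : Measurable[m₁] U) (hV : Measurable[m₂] V) :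
    a * ((∫⁻ ω, U ω ∂P) * ∫⁻ ω, V ω ∂P) + b * ∫⁻ ω, U ω * V ω ∂P ≤
      a' * ((∫⁻ ω, U ω ∂P) * ∫⁻ ω, V ω ∂P) + b' * ∫⁻ ω, U ω * V ω ∂P := by
  have step : ∀ B, MeasurableSet[m₂] B →
      a * ((∫⁻ ω, U ω ∂P) * P B) + b * ∫⁻ ω in B, U ω ∂P ≤
        a' * ((∫⁻ ω, U ω ∂P) * P B) + b' * ∫⁻ ω in B, U ω ∂P := by
    intro B hB
    have hle : (a * P B) • P.trim h₁ + b • (P.restrict B).trim h₁ ≤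
        (a' * P B) • P.trim h₁ + b' • (P.restrict B).trim h₁ := by
      refine Measure.le_iff.2 fun A hA => ?_
      simp only [Measure.add_apply, Measure.smul_apply, smul_eq_mul,
        trim_measurableSet_eq h₁ hA, Measure.restrict_apply (h₁ A hA)]
      have := h A B hA hB
      calc a * P B * P A + b * P (A ∩ B) = a * (P A * P B) + b * P (A ∩ B) := by ring
        _ ≤ _ := this
        _ = _ := by ring
    have := lintegral_mono' hle (le_refl U)
    simp only [lintegral_add_measure, lintegral_smul_measure, smul_eq_mul,
      lintegral_trim h₁ hU] at this
    calc _ = a * P B * ∫⁻ ω, U ω ∂P + b * ∫⁻ ω in B, U ω ∂P := by ring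
      _ ≤ _ := this
      _ = _ := by ring
  have hU0 : Measurable U := hU.mono h₁ le_rfl
  have hV0 : Measurable V := hV.mono h₂ le_rfl
  have hle : (a * ∫⁻ ω, U ω ∂P) • P.trim h₂ + b • (P.withDensity U).trim h₂ ≤
      (a' * ∫⁻ ω, U ω ∂P) • P.trim h₂ + b' • (P.withDensity U).trim h₂ := by
    refine Measure.le_iff.2 fun B hB => ?_
    simp only [Measure.add_apply, Measure.smul_apply, smul_eq_mul,
      trim_measurableSet_eq h₂ hB, withDensity_apply _ (h₂ B hB)]
    simpa only [mul_assoc] using step B hB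
  have := lintegral_mono' hle (le_refl V)
  simp only [lintegral_add_measure, lintegral_smul_measure, smul_eq_mul,
    lintegral_trim h₂ hV, lintegral_withDensity_eq_lintegral_mul _ hU0 hV0,
    Pi.mul_apply] at this
  simpa only [mul_assoc] using this

theorem IsPsiMixing.abs_integral_sub_le_of_nonneg [IsProbabilityMeasure P]
    (h₁ : m₁ ≤ m0) (h₂ : m₂ ≤ m0) {c : ℝ} (hc : 0 ≤ c) (h : IsPsiMixing m₁ m₂ P c)
    {U V : Ω → ℝ} (hU : Measurable[m₁] U) (hV : Measurable[m₂] V) (hU0 : 0 ≤ U) (hV0 : 0 ≤ V)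
    (hUi : Integrable U P) (hVi : Integrable V P) (hUV : Integrable (fun ω => U ω * V ω) P) :
    |∫ ω, U ω * V ω ∂P - (∫ ω, U ω ∂P) * ∫ ω, V ω ∂P| ≤
      c * ((∫ ω, U ω ∂P) * ∫ ω, V ω ∂P) := by
  have hPA : ∀ A, P A = ENNReal.ofReal (P.real A) := fun A => by simp
  have hIU := ofReal_integral_eq_lintegral_ofReal hUi (ae_of_all _ hU0)
  have hIV := ofReal_integral_eq_lintegral_ofReal hVi (ae_of_all _ hV0)
  have hIUV := ofReal_integral_eq_lintegral_ofReal hUV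
    (ae_of_all _ fun ω => mul_nonneg (hU0 ω) (hV0 ω))
  simp only [fun ω => ENNReal.ofReal_mul (q := V ω) (hU0 ω)] at hIUV
  have hU' : Measurable[m₁] fun ω => ENNReal.ofReal (U ω) :=
    ENNReal.measurable_ofReal.comp hU
  have hV' : Measurable[m₂] fun ω => ENNReal.ofReal (V ω) :=
    ENNReal.measurable_ofReal.comp hV
  have nU : 0 ≤ ∫ ω, U ω ∂P := integral_nonneg hU0
  have nV : 0 ≤ ∫ ω, V ω ∂P := integral_nonneg hV0
  have nUV : 0 ≤ ∫ ω, U ω * V ω ∂P := integral_nonneg fun ω => mul_nonneg (hU0 ω) (hV0 ω)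
  have key := fun (a b a' b' : ℝ) hh =>
    lintegral_mul_lintegral_le_of_forall_measurableSet (P := P) h₁ h₂
      (a := ENNReal.ofReal a) (b := ENNReal.ofReal b) (a' := ENNReal.ofReal a')
      (b' := ENNReal.ofReal b') hh hU' hV'
  have key' : ∀ a b a' b' : ℝ, 0 ≤ a → 0 ≤ b → 0 ≤ a' → 0 ≤ b' →
      (∀ A B, MeasurableSet[m₁] A → MeasurableSet[m₂] B →
        a * (P.real A * P.real B) + b * P.real (A ∩ B) ≤
          a' * (P.real A * P.real B) + b' * P.real (A ∩ B)) →
      a * ((∫ ω, U ω ∂P) * ∫ ω, V ω ∂P) + b * ∫ ω, U ω * V ω ∂P ≤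
        a' * ((∫ ω, U ω ∂P) * ∫ ω, V ω ∂P) + b' * ∫ ω, U ω * V ω ∂P := by
    intro a b a' b' ha hb ha' hb' hh
    have conv : ∀ s t u v w : ℝ, 0 ≤ s → 0 ≤ t → 0 ≤ u → 0 ≤ v → 0 ≤ w →
        ENNReal.ofReal s * (ENNReal.ofReal u * ENNReal.ofReal v) +
          ENNReal.ofReal t * ENNReal.ofReal w = ENNReal.ofReal (s * (u * v) + t * w) := by
      intro s t u v w hs ht hu hv hw
      rw [ENNReal.ofReal_add (by positivity) (by positivity), ENNReal.ofReal_mul hs,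
        ENNReal.ofReal_mul hu, ENNReal.ofReal_mul ht]
    have := key a b a' b' (fun A B hA hB => by
      rw [hPA A, hPA B, hPA (A ∩ B)]
      rw [conv _ _ _ _ _ ha hb (by positivity) (by positivity) (by positivity),
        conv _ _ _ _ _ ha' hb' (by positivity) (by positivity) (by positivity)]
      exact ENNReal.ofReal_le_ofReal (hh A B hA hB))
    rw [← hIU, ← hIV, ← hIUV, conv _ _ _ _ _ ha hb nU nV nUV,
      conv _ _ _ _ _ ha' hb' nU nV nUV] at this
    exact (ENNReal.ofReal_le_ofReal_iff (by positivity)).1 this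
  -- The two halves of the absolute value: `P(A ∩ B) ≤ (1 + c) P(A) P(B)` and
  -- `P(A) P(B) ≤ c P(A) P(B) + P(A ∩ B)`.
  have k1 := key' 0 1 (1 + c) 0 le_rfl zero_le_one (by positivity) le_rfl (fun A B hA hB => by
    have := (abs_le.1 (h A B hA hB)).2
    linarith)
  have k2 := key' 1 0 c 1 zero_le_one le_rfl hc zero_le_one (fun A B hA hB => by
    have := (abs_le.1 (h A B hA hB)).1
    linarith)
  exact abs_le.2 ⟨by linarith, by linarith⟩

/-- Covariance inequality for `ψ`-mixing, by splitting both variables into their positive and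
negative parts. -/
theorem IsPsiMixing.abs_integral_sub_le [IsProbabilityMeasure P]
    (h₁ : m₁ ≤ m0) (h₂ : m₂ ≤ m0) {c : ℝ} (hc : 0 ≤ c) (h : IsPsiMixing m₁ m₂ P c)
    {U V : Ω → ℝ} (hU : Measurable[m₁] U) (hV : Measurable[m₂] V)
    (hUi : MemLp U 2 P) (hVi : MemLp V 2 P) :
    |∫ ω, U ω * V ω ∂P - (∫ ω, U ω ∂P) * ∫ ω, V ω ∂P| ≤
      c * ((∫ ω, |U ω| ∂P) * ∫ ω, |V ω| ∂P) := by
  set Up : Ω → ℝ := fun ω => max (U ω) 0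
  set Un : Ω → ℝ := fun ω => max (-U ω) 0
  set Vp : Ω → ℝ := fun ω => max (V ω) 0
  set Vn : Ω → ℝ := fun ω => max (-V ω) 0
  have mUp : MemLp Up 2 P := hUi.pos_part
  have mUn : MemLp Un 2 P := hUi.neg_part
  have mVp : MemLp Vp 2 P := hVi.pos_part
  have mVn : MemLp Vn 2 P := hVi.neg_part
  have meUp : Measurable[m₁] Up := (measurable_id.max measurable_const).comp hU
  have meUn : Measurable[m₁] Un := (measurable_neg.max measurable_const).comp hU
  have meVp : Measurable[m₂] Vp := (measurable_id.max measurable_const).comp hV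
  have meVn : Measurable[m₂] Vn := (measurable_neg.max measurable_const).comp hV
  have iUp := mUp.integrable one_le_two
  have iUn := mUn.integrable one_le_two
  have iVp := mVp.integrable one_le_two
  have iVn := mVn.integrable one_le_two
  have ipp : Integrable (fun ω => Up ω * Vp ω) P := mUp.integrable_mul mVp
  have ipn : Integrable (fun ω => Up ω * Vn ω) P := mUp.integrable_mul mVn
  have inp : Integrable (fun ω => Un ω * Vp ω) P := mUn.integrable_mul mVp
  have inn : Integrable (fun ω => Un ω * Vn ω) P := mUn.integrable_mul mVn
  have nn : ∀ f : Ω → ℝ, (0 : Ω → ℝ) ≤ fun ω => max (f ω) 0 := fun f ω => le_max_right _ _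
  have bpp := h.abs_integral_sub_le_of_nonneg h₁ h₂ hc meUp meVp (nn _) (nn _) iUp iVp ipp
  have bpn := h.abs_integral_sub_le_of_nonneg h₁ h₂ hc meUp meVn (nn _) (nn _) iUp iVn ipn
  have bnp := h.abs_integral_sub_le_of_nonneg h₁ h₂ hc meUn meVp (nn _) (nn _) iUn iVp inp
  have bnn := h.abs_integral_sub_le_of_nonneg h₁ h₂ hc meUn meVn (nn _) (nn _) iUn iVn inn
  have eU : ∀ ω, U ω = Up ω - Un ω := fun ω => by
    rcases le_total 0 (U ω) with h | h <;> simp [Up, Un, h]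
  have eV : ∀ ω, V ω = Vp ω - Vn ω := fun ω => by
    rcases le_total 0 (V ω) with h | h <;> simp [Vp, Vn, h]
  have aU : ∀ ω, |U ω| = Up ω + Un ω := fun ω => by
    rcases le_total 0 (U ω) with h | h <;> simp [Up, Un, h, abs_of_nonneg, abs_of_nonpos]
  have aV : ∀ ω, |V ω| = Vp ω + Vn ω := fun ω => by
    rcases le_total 0 (V ω) with h | h <;> simp [Vp, Vn, h, abs_of_nonneg, abs_of_nonpos]
  have hUV : ∫ ω, U ω * V ω ∂P = ∫ ω, Up ω * Vp ω ∂P - ∫ ω, Up ω * Vn ω ∂P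
      - ∫ ω, Un ω * Vp ω ∂P + ∫ ω, Un ω * Vn ω ∂P := by
    have i₁ : Integrable (fun ω => Up ω * Vp ω - Up ω * Vn ω) P := ipp.sub ipn
    have i₂ : Integrable (fun ω => Up ω * Vp ω - Up ω * Vn ω - Un ω * Vp ω) P := i₁.sub inp
    rw [← integral_sub ipp ipn, ← integral_sub i₁ inp, ← integral_add i₂ inn]
    refine integral_congr_ae (ae_of_all _ fun ω => ?_)
    simp only [eU, eV]
    ring
  rw [hUV, integral_congr_ae (ae_of_all _ aU), integral_congr_ae (ae_of_all _ aV),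
    integral_congr_ae (ae_of_all _ eU), integral_congr_ae (ae_of_all _ eV),
    integral_add iUp iUn, integral_add iVp iVn, integral_sub iUp iUn, integral_sub iVp iVn]
  rw [abs_le] at bpp bpn bnp bnn ⊢
  constructor <;> nlinarith

theorem sq_integral_abs_le [IsProbabilityMeasure P] {U : Ω → ℝ} (hU : MemLp U 2 P) :
    (∫ ω, |U ω| ∂P) ^ 2 ≤ ∫ ω, U ω ^ 2 ∂P := by
  have h := variance_nonneg (fun ω => |U ω|) P
  rw [variance_eq_sub (show MemLp (fun ω => |U ω|) 2 P from hU.abs)] at h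
  simp only [Pi.pow_apply, sq_abs] at h
  linarith

theorem abs_integral_mul_le {U V : Ω → ℝ} (hU : MemLp U 2 P) (hV : MemLp V 2 P) {D : ℝ}
    (hUD : ∫ ω, U ω ^ 2 ∂P ≤ D) (hVD : ∫ ω, V ω ^ 2 ∂P ≤ D) :
    |∫ ω, U ω * V ω ∂P| ≤ D := by
  refine (abs_integral_le_integral_abs).trans ?_
  have h : ∫ ω, |U ω * V ω| ∂P ≤ ∫ ω, (U ω ^ 2 + V ω ^ 2) / 2 ∂P := by
    refine integral_mono (hU.integrable_mul hV).abs
      ((hU.integrable_sq.add hV.integrable_sq).div_const 2) fun ω => ?_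
    simp only [abs_mul]
    nlinarith [sq_nonneg (|U ω| - |V ω|), sq_abs (U ω), sq_abs (V ω)]
  rw [integral_div, integral_add hU.integrable_sq hV.integrable_sq] at h
  linarith

theorem IsPsiMixing.abs_covariance_le [IsProbabilityMeasure P]
    (h₁ : m₁ ≤ m0) (h₂ : m₂ ≤ m0) {c : ℝ} (hc : 0 ≤ c) (h : IsPsiMixing m₁ m₂ P c)
    {U V : Ω → ℝ} (hU : Measurable[m₁] U) (hV : Measurable[m₂] V)
    (hUi : MemLp U 2 P) (hVi : MemLp V 2 P) {D : ℝ}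
    (hUD : ∫ ω, U ω ^ 2 ∂P ≤ D) (hVD : ∫ ω, V ω ^ 2 ∂P ≤ D) :
    |covariance U V P| ≤ c * D := by
  rw [covariance_eq_sub hUi hVi]
  refine (h.abs_integral_sub_le h₁ h₂ hc hU hV hUi hVi).trans
    (mul_le_mul_of_nonneg_left ?_ hc)
  have a := sq_integral_abs_le hUi
  have b := sq_integral_abs_le hVi
  nlinarith [sq_nonneg ((∫ ω, |U ω| ∂P) - ∫ ω, |V ω| ∂P)]

theorem abs_covariance_le_of_integral_sq_le [IsProbabilityMeasure P] {U V : Ω → ℝ} (hU : MemLp U 2 P)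
    (hV : MemLp V 2 P) {D : ℝ}
    (hUD : ∫ ω, U ω ^ 2 ∂P ≤ D) (hVD : ∫ ω, V ω ^ 2 ∂P ≤ D) :
    |covariance U V P| ≤ D := by
  have key : ∀ W : Ω → ℝ, MemLp W 2 P → ∫ ω, W ω ^ 2 ∂P ≤ D →
      ∫ ω, (W ω - ∫ ω', W ω' ∂P) ^ 2 ∂P ≤ D := by
    intro W hW hWD
    rw [← variance_eq_integral hW.aestronglyMeasurable.aemeasurable]
    exact (variance_le_expectation_sq hW.aestronglyMeasurable).trans hWD
  exact abs_integral_mul_le (hU.sub (memLp_const _)) (hV.sub (memLp_const _))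
    (key U hU hUD) (key V hV hVD)

variable {ι : Type*}

theorem pastSigma_le {y : ℤ → Ω → ι → ℝ} (hy : ∀ t, Measurable (y t)) (t : ℤ) :
    pastSigma y t ≤ m0 :=
  iSup_le fun s => (hy s).comap_le

theorem futureSigma_le {y : ℤ → Ω → ι → ℝ} (hy : ∀ t, Measurable (y t)) (t : ℤ) :
    futureSigma y t ≤ m0 :=
  iSup_le fun s => (hy s).comap_le

theorem isPsiMixing_psiCoeff [IsProbabilityMeasure P] {y : ℤ → Ω → ι → ℝ} {k : ℕ} (hk : psiCoeff P y k ≠ ∞) (t : ℤ) :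
    IsPsiMixing (pastSigma y t) (futureSigma y (t + k)) P (psiCoeff P y k).toReal := by
  intro A B hA hB
  by_cases hA0 : P A = 0
  · have h1 : P.real A = 0 := by simp [Measure.real, hA0]
    have h2 : P.real (A ∩ B) = 0 := by
      simp [Measure.real, measure_mono_null Set.inter_subset_left hA0]
    simp [h1, h2]
  by_cases hB0 : P B = 0
  · have h1 : P.real B = 0 := by simp [Measure.real, hB0]
    have h2 : P.real (A ∩ B) = 0 := by
      simp [Measure.real, measure_mono_null Set.inter_subset_right hB0]
    simp [h1, h2]
  have pA : 0 < P.real A := ENNReal.toReal_pos hA0 (measure_ne_top _ _)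
  have pB : 0 < P.real B := ENNReal.toReal_pos hB0 (measure_ne_top _ _)
  have hle : ENNReal.ofReal |P.real (A ∩ B) / (P.real A * P.real B) - 1| ≤ psiCoeff P y k := by
    unfold psiCoeff
    refine le_iSup_of_le t <| le_iSup_of_le A <| le_iSup_of_le B <| le_iSup_of_le hA <|
      le_iSup_of_le hB <| le_iSup_of_le hA0 <| le_iSup_of_le hB0 le_rfl
  have hle' := (ENNReal.ofReal_le_iff_le_toReal hk).1 hle
  have hpos := mul_pos pA pB
  have e : P.real (A ∩ B) - P.real A * P.real B =
      (P.real (A ∩ B) / (P.real A * P.real B) - 1) * (P.real A * P.real B) := by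
    field_simp
  rw [e, abs_mul, abs_of_pos hpos]
  exact mul_le_mul_of_nonneg_right hle' hpos.le

/-- Each distance from `s` is attained at most twice in `{1, …, N}`. -/
theorem sum_dist_le (h : ℕ → ℝ) (h0 : ∀ d, 0 ≤ h d) (N s : ℕ) (hs : s ∈ Finset.Icc 1 N) :
    ∑ t ∈ Finset.Icc 1 N, h (Nat.dist s t) ≤ 2 * ∑ d ∈ Finset.range N, h d := by
  classical
  rw [← Finset.sum_filter_add_sum_filter_not (Finset.Icc 1 N) (fun t => s ≤ t), two_mul]
  have aux : ∀ T : Finset ℕ, T ⊆ Finset.Icc 1 N → Set.InjOn (Nat.dist s) T →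
      ∑ t ∈ T, h (Nat.dist s t) ≤ ∑ d ∈ Finset.range N, h d := by
    intro T hT hinj
    rw [← Finset.sum_image (f := h) hinj]
    refine Finset.sum_le_sum_of_subset_of_nonneg (fun d hd => ?_) fun d _ _ => h0 d
    obtain ⟨t, ht, rfl⟩ := Finset.mem_image.1 hd
    have := Finset.mem_Icc.1 (hT ht)
    have := Finset.mem_Icc.1 hs
    rw [Finset.mem_range, Nat.dist]
    omega
  refine add_le_add (aux _ (Finset.filter_subset _ _) ?_) (aux _ (Finset.filter_subset _ _) ?_)
  all_goals
    intro a ha b hb hab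
    simp only [Finset.coe_filter, Set.mem_ofPred_eq, Nat.dist] at ha hb hab
    omega

/-- The variance of a sum of `N` terms, each depending on the path of `y` over `k` time steps,
grows at most linearly in `N` if the mixing coefficients of `y` are summable. -/
theorem variance_sum_le [IsProbabilityMeasure P] {y : ℤ → Ω → ι → ℝ} (hy : ∀ t, Measurable (y t)) {S : ℝ}
    (hfin : ∀ e : ℕ, psiCoeff P y (e + 1) ≠ ∞)
    (hS : ∀ N : ℕ, ∑ e ∈ Finset.range N, (psiCoeff P y (e + 1)).toReal ≤ S)
    (k : ℕ) (W : ℕ → Ω → ℝ)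
    (hpast : ∀ t : ℕ, Measurable[pastSigma y ((t : ℤ) + k)] (W t))
    (hfut : ∀ t : ℕ, Measurable[futureSigma y t] (W t))
    (hW : ∀ t, MemLp (W t) 2 P) {D : ℝ} (hD : ∀ t, ∫ ω, W t ω ^ 2 ∂P ≤ D) (N : ℕ) :
    variance (fun ω => ∑ t ∈ Finset.Icc 1 N, W t ω) P ≤ N * (2 * (D * (k + 1 + S))) := by
  have hD0 : 0 ≤ D := (integral_nonneg fun ω => sq_nonneg _).trans (hD 0)
  -- Terms at distance at most `k` may share observations; beyond that the gap is `d - k`.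
  set h : ℕ → ℝ := fun d => if d ≤ k then D else (psiCoeff P y (d - k)).toReal * D with hh
  have h0 : ∀ d, 0 ≤ h d := fun d => by
    simp only [hh]; split_ifs <;> positivity
  have hlt : ∀ s t : ℕ, s ≤ t → |covariance (W s) (W t) P| ≤ h (t - s) := by
    intro s t hst
    simp only [hh]
    split_ifs with hk
    · exact abs_covariance_le_of_integral_sq_le (hW s) (hW t) (hD s) (hD t)
    · obtain ⟨e, he⟩ : ∃ e, t - s - k = e + 1 := ⟨t - s - k - 1, by omega⟩
      have hmix := isPsiMixing_psiCoeff (P := P) (y := y) (hfin e) ((s : ℤ) + k)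
      have ht : (s : ℤ) + k + ((e + 1 : ℕ) : ℤ) = t := by omega
      rw [ht] at hmix
      rw [he]
      exact hmix.abs_covariance_le (pastSigma_le hy _) (futureSigma_le hy _)
        ENNReal.toReal_nonneg (hpast s) (hfut t) (hW s) (hW t) (hD s) (hD t)
  have hcov : ∀ s t : ℕ, covariance (W s) (W t) P ≤ h (Nat.dist s t) := by
    intro s t
    rcases le_total s t with hst | hst
    · rw [Nat.dist_eq_sub_of_le hst]; exact (le_abs_self _).trans (hlt s t hst)
    · rw [Nat.dist_eq_sub_of_le_right hst, covariance_comm]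
      exact (le_abs_self _).trans (hlt t s hst)
  have hsum : ∑ d ∈ Finset.range N, h d ≤ D * (k + 1 + S) := by
    calc ∑ d ∈ Finset.range N, h d ≤ ∑ d ∈ Finset.range (k + 1 + N), h d :=
          Finset.sum_le_sum_of_subset_of_nonneg
            (Finset.range_mono (by omega)) fun d _ _ => h0 d
      _ = ∑ d ∈ Finset.range (k + 1), h d + ∑ e ∈ Finset.range N, h (k + 1 + e) :=
          Finset.sum_range_add _ _ _
      _ = (k + 1) * D + (∑ e ∈ Finset.range N, (psiCoeff P y (e + 1)).toReal) * D := by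
          congr 1
          · rw [Finset.sum_congr rfl (g := fun _ => D) fun d hd => ?_]
            · simp
            · have := Finset.mem_range.1 hd
              simp only [hh]; rw [if_pos (by omega)]
          · rw [Finset.sum_mul]
            refine Finset.sum_congr rfl fun e _ => ?_
            simp only [hh]
            rw [if_neg (by omega), show k + 1 + e - k = e + 1 by omega]
      _ ≤ (k + 1) * D + S * D := by gcongr; exact hS N
      _ = _ := by ring
  have hmem : MemLp (fun ω => ∑ t ∈ Finset.Icc 1 N, W t ω) 2 P :=
    memLp_finsetSum _ fun t _ => hW t
  rw [← covariance_self hmem.aestronglyMeasurable.aemeasurable,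
    covariance_fun_sum_fun_sum' (fun t _ => hW t) (fun t _ => hW t)]
  calc ∑ s ∈ Finset.Icc 1 N, ∑ t ∈ Finset.Icc 1 N, covariance (W s) (W t) P
      ≤ ∑ s ∈ Finset.Icc 1 N, 2 * (D * (k + 1 + S)) := by
        refine Finset.sum_le_sum fun s hs => ?_
        refine (Finset.sum_le_sum fun t _ => hcov s t).trans ?_
        refine (sum_dist_le h h0 N s hs).trans ?_
        exact mul_le_mul_of_nonneg_left hsum zero_le_two
    _ = _ := by simp

end Mixing

/-! ### Moments of a centred stationary process -/

section Moments

variable {Ω : Type*} [MeasurableSpace Ω] {P : Measure Ω}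

theorem memLp_four_of_lintegral_le {X : Ω → ℝ} (hX : Measurable X) {C : ℝ≥0}
    (h : ∫⁻ ω, ‖X ω‖ₑ ^ 4 ∂P ≤ C) : MemLp X 4 P := by
  refine ⟨hX.aestronglyMeasurable, ?_⟩
  rw [eLpNorm_lt_top_iff_lintegral_rpow_enorm_lt_top (by norm_num) (by norm_num)]
  have e : ∀ ω, ‖X ω‖ₑ ^ (4 : ℝ≥0∞).toReal = ‖X ω‖ₑ ^ 4 := fun ω => by
    rw [show (4 : ℝ≥0∞).toReal = ((4 : ℕ) : ℝ) by norm_num, ENNReal.rpow_natCast]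
  simp only [e]
  exact h.trans_lt ENNReal.coe_lt_top

theorem integral_pow_four_le {X : Ω → ℝ} (hX : Measurable X) {C : ℝ≥0}
    (h : ∫⁻ ω, ‖X ω‖ₑ ^ 4 ∂P ≤ C) : ∫ ω, X ω ^ 4 ∂P ≤ C := by
  have e : ∀ ω, ENNReal.ofReal (X ω ^ 4) = ‖X ω‖ₑ ^ 4 := fun ω => by
    rw [show X ω ^ 4 = ‖X ω‖ ^ 4 by rw [Real.norm_eq_abs, Even.pow_abs (by decide)],
      ENNReal.ofReal_pow (norm_nonneg _), ofReal_norm]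
  rw [integral_eq_lintegral_of_nonneg_ae
    (ae_of_all _ fun ω => Even.pow_nonneg (by decide) _) (hX.pow_const 4).aestronglyMeasurable]
  simp only [e]
  exact ENNReal.toReal_le_of_le_ofReal C.2 (by simpa using h)

theorem memLp_two_mul {X Y : Ω → ℝ} (hX : MemLp X 4 P) (hY : MemLp Y 4 P) :
    MemLp (fun ω => X ω * Y ω) 2 P := by
  have : ENNReal.HolderTriple 4 4 2 := ⟨by
    rw [← two_mul, show (4 : ℝ≥0∞) = 2 * 2 by norm_num,
      ENNReal.mul_inv (by norm_num) (by norm_num), ← mul_assoc,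
      ENNReal.mul_inv_cancel (by norm_num) (by norm_num), one_mul]⟩
  exact MemLp.mul (p := 4) (q := 4) (r := 2) hY hX

theorem memLp_two_sq {X : Ω → ℝ} (hX : MemLp X 4 P) : MemLp (fun ω => X ω ^ 2) 2 P := by
  simpa only [sq] using memLp_two_mul hX hX

theorem integrable_pow_four {X : Ω → ℝ} (hX : MemLp X 4 P) :
    Integrable (fun ω => X ω ^ 4) P := by
  have := (memLp_two_sq hX).integrable_sq
  simpa only [← pow_mul] using this

theorem integral_mul_sq_le {X Y : Ω → ℝ} (hX : MemLp X 4 P) (hY : MemLp Y 4 P) {D : ℝ}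
    (hXD : ∫ ω, X ω ^ 4 ∂P ≤ D) (hYD : ∫ ω, Y ω ^ 4 ∂P ≤ D) :
    ∫ ω, (X ω * Y ω) ^ 2 ∂P ≤ D := by
  have h : ∫ ω, (X ω * Y ω) ^ 2 ∂P ≤ ∫ ω, (X ω ^ 4 + Y ω ^ 4) / 2 ∂P := by
    refine integral_mono (memLp_two_mul hX hY).integrable_sq
      (((integrable_pow_four hX).add (integrable_pow_four hY)).div_const 2) fun ω => ?_
    simp only
    nlinarith [sq_nonneg (X ω ^ 2 - Y ω ^ 2)]
  rw [integral_div, integral_add (integrable_pow_four hX) (integrable_pow_four hY)] at h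
  linarith

theorem integral_sub_pow_four_le [IsProbabilityMeasure P] {X : Ω → ℝ} (hX : MemLp X 4 P)
    {C : ℝ} (hC : ∫ ω, X ω ^ 4 ∂P ≤ C) :
    ∫ ω, (X ω - ∫ ω', X ω' ∂P) ^ 4 ∂P ≤ 16 * C := by
  set m := ∫ ω', X ω' ∂P with hm
  have h2 : MemLp X 2 P := hX.mono_exponent (by norm_num)
  have hm2 : m ^ 2 ≤ ∫ ω, X ω ^ 2 ∂P := by
    have h := variance_nonneg X P
    rw [variance_eq_sub h2] at h
    simp only [Pi.pow_apply] at h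
    linarith
  have hm4 : m ^ 4 ≤ C := by
    have h := sq_integral_abs_le (memLp_two_sq hX)
    simp only [abs_pow, sq_abs, ← pow_mul] at h
    refine le_trans ?_ (h.trans hC)
    rw [show m ^ 4 = (m ^ 2) ^ 2 by ring]
    exact pow_le_pow_left₀ (sq_nonneg _) hm2 2
  have h : ∫ ω, (X ω - m) ^ 4 ∂P ≤ ∫ ω, 8 * (X ω ^ 4 + m ^ 4) ∂P := by
    refine integral_mono (integrable_pow_four (hX.sub (memLp_const m)))
      (((integrable_pow_four hX).add (integrable_const _)).const_mul 8) fun ω => ?_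
    simp only
    nlinarith [sq_nonneg (X ω + m), sq_nonneg (X ω ^ 2 - m ^ 2), sq_nonneg (X ω - m),
      sq_nonneg ((X ω + m) * (X ω - m)), sq_nonneg ((X ω + m) * (X ω + m)),
      sq_nonneg ((X ω - m) * (X ω - m)), mul_nonneg (sq_nonneg (X ω + m)) (sq_nonneg (X ω - m))]
  rw [integral_const_mul, integral_add (integrable_pow_four hX) (integrable_const _)] at h
  simp only [integral_const, probReal_univ, one_smul] at h
  linarith

theorem integral_sq_le_one_add [IsProbabilityMeasure P] {X : Ω → ℝ} (hX : MemLp X 4 P) :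
    ∫ ω, X ω ^ 2 ∂P ≤ ∫ ω, X ω ^ 4 ∂P + 1 := by
  have h : ∫ ω, X ω ^ 2 ∂P ≤ ∫ ω, (X ω ^ 4 + 1) ∂P := by
    refine integral_mono (hX.mono_exponent (by norm_num : (2 : ℝ≥0∞) ≤ 4)).integrable_sq
      ((integrable_pow_four hX).add (integrable_const _)) fun ω => ?_
    simp only
    nlinarith [sq_nonneg (X ω ^ 2 - 1)]
  rw [integral_add (integrable_pow_four hX) (integrable_const _)] at h
  simpa using h

theorem IsStrictlyStationary.integral_shift {ι : Type*} {y : ℤ → Ω → ι → ℝ}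
    (hs : IsStrictlyStationary P y) (hy : ∀ t, Measurable (y t)) (h : ℤ)
    {g : (ℤ → ι → ℝ) → ℝ} (hg : Measurable g) :
    ∫ ω, g (fun t => y (t + h) ω) ∂P = ∫ ω, g (fun t => y t ω) ∂P := by
  rw [← integral_map (φ := fun ω t => y (t + h) ω)
      (measurable_pi_lambda _ fun t => hy (t + h)).aemeasurable hg.aestronglyMeasurable,
    hs h, integral_map (measurable_pi_lambda _ hy).aemeasurable hg.aestronglyMeasurable]

/-- The process `y` with the means `∫ y_{0,i}` subtracted. -/
noncomputable def centred {ι : Type*} (P : Measure Ω) (y : ℤ → Ω → ι → ℝ) (t : ℤ) (ω : Ω) (i : ι) : ℝ :=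
  y t ω i - ∫ ω', y 0 ω' i ∂P

/-- The hypotheses on a single process under which the sample autocovariances are estimated: it is
strictly stationary, its `ψ`-mixing coefficients at positive lags are finite with sum at most
`S`, and its components have fourth moments at most `C`. -/
structure IsMixingWithMoments {ι : Type*} (P : Measure Ω) (y : ℤ → Ω → ι → ℝ) (S : ℝ)
    (C : ℝ≥0) : Prop where
  measurable : ∀ t, Measurable (y t)
  stationary : IsStrictlyStationary P y
  psi_ne_top : ∀ e : ℕ, psiCoeff P y (e + 1) ≠ ∞
  psi_sum_le : ∀ N : ℕ, ∑ e ∈ Finset.range N, (psiCoeff P y (e + 1)).toReal ≤ S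
  moment_le : ∀ t i, ∫⁻ ω, ‖y t ω i‖ₑ ^ 4 ∂P ≤ C

namespace IsMixingWithMoments

variable {ι : Type*} {y : ℤ → Ω → ι → ℝ} {S : ℝ} {C : ℝ≥0}

theorem measurable_apply (h : IsMixingWithMoments P y S C) (t : ℤ) (i : ι) :
    Measurable fun ω => y t ω i :=
  (measurable_pi_apply i).comp (h.measurable t)

theorem memLp (h : IsMixingWithMoments P y S C) (t : ℤ) (i : ι) :
    MemLp (fun ω => y t ω i) 4 P :=
  memLp_four_of_lintegral_le (h.measurable_apply t i) (h.moment_le t i)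

theorem integral_eq (h : IsMixingWithMoments P y S C) (t : ℤ) (i : ι) :
    ∫ ω, y t ω i ∂P = ∫ ω, y 0 ω i ∂P := by
  have := h.stationary.integral_shift h.measurable t (g := fun f => f 0 i) (by fun_prop)
  simpa using this

theorem integral_centred_mul (h : IsMixingWithMoments P y S C) (t : ℤ) (k : ℕ) (i j : ι) :
    ∫ ω, centred P y (t + k) ω i * centred P y t ω j ∂P = crossCov P (y k) (y 0) i j := by
  have := h.stationary.integral_shift h.measurable t
    (g := fun f => (f k i - ∫ ω', y 0 ω' i ∂P) * (f 0 j - ∫ ω', y 0 ω' j ∂P)) (by fun_prop)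
  simp only [crossCov, Matrix.of_apply, covariance]
  rw [h.integral_eq k i]
  rw [← this]
  refine integral_congr_ae (ae_of_all _ fun ω => ?_)
  simp [centred, add_comm]

variable [IsProbabilityMeasure P]

theorem memLp_centred (h : IsMixingWithMoments P y S C) (t : ℤ) (i : ι) :
    MemLp (fun ω => centred P y t ω i) 4 P :=
  (h.memLp t i).sub (memLp_const _)

theorem integral_centred_pow_four_le (h : IsMixingWithMoments P y S C) (t : ℤ) (i : ι) :
    ∫ ω, centred P y t ω i ^ 4 ∂P ≤ 16 * C + 1 := by
  have := integral_sub_pow_four_le (h.memLp t i)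
    (integral_pow_four_le (h.measurable_apply t i) (h.moment_le t i))
  rw [h.integral_eq t i] at this
  exact this.trans (by linarith)

theorem integral_centred_sq_le (h : IsMixingWithMoments P y S C) (t : ℤ) (i : ι) :
    ∫ ω, centred P y t ω i ^ 2 ∂P ≤ 16 * C + 1 := by
  have := integral_sub_pow_four_le (h.memLp t i)
    (integral_pow_four_le (h.measurable_apply t i) (h.moment_le t i))
  rw [h.integral_eq t i] at this
  exact (integral_sq_le_one_add (h.memLp_centred t i)).trans (by
    unfold centred; linarith)

theorem integral_centred (h : IsMixingWithMoments P y S C) (t : ℤ) (i : ι) :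
    ∫ ω, centred P y t ω i ∂P = 0 := by
  unfold centred
  rw [integral_sub ((h.memLp t i).integrable (by norm_num)) (integrable_const _),
    h.integral_eq t i]
  simp

theorem abs_crossCov_le (h : IsMixingWithMoments P y S C) (k : ℕ) (i j : ι) :
    |crossCov P (y k) (y 0) i j| ≤ 16 * C + 1 := by
  rw [← h.integral_centred_mul 0 k i j]
  exact abs_integral_mul_le ((h.memLp_centred _ i).mono_exponent (by norm_num))
    ((h.memLp_centred _ j).mono_exponent (by norm_num)) (h.integral_centred_sq_le _ i)
    (h.integral_centred_sq_le _ j)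

/-- Mean square of `∑_{t=1}^N (z_{t+k,i} z_{t,j} - σ_{ij}(k))` for the centred process `z`. -/
theorem integral_sum_mul_sq_le (h : IsMixingWithMoments P y S C) (k N : ℕ) (i j : ι) :
    ∫ ω, (∑ t ∈ Finset.Icc 1 N, (centred P y ((t : ℤ) + k) ω i * centred P y t ω j -
        crossCov P (y k) (y 0) i j)) ^ 2 ∂P ≤ N * (2 * ((16 * C + 1) * (k + 1 + S))) := by
  have hmem : ∀ t : ℕ,
      MemLp (fun ω => centred P y ((t : ℤ) + k) ω i * centred P y t ω j) 2 P := fun t =>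
    memLp_two_mul (h.memLp_centred _ i) (h.memLp_centred _ j)
  have hv := variance_sum_le h.measurable h.psi_ne_top h.psi_sum_le k
    (fun t ω => centred P y ((t : ℤ) + k) ω i * centred P y t ω j)
    (fun t => ((measurable_pastSigma y le_rfl i).sub_const _).mul
      ((measurable_pastSigma y (by omega) j).sub_const _))
    (fun t => ((measurable_futureSigma y (by omega) i).sub_const _).mul
      ((measurable_futureSigma y le_rfl j).sub_const _))
    hmem (fun t => integral_mul_sq_le (h.memLp_centred _ i) (h.memLp_centred _ j)
      (h.integral_centred_pow_four_le _ i) (h.integral_centred_pow_four_le _ j)) N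
  rw [variance_eq_integral
    (memLp_finsetSum _ fun t _ => hmem t).aestronglyMeasurable.aemeasurable,
    integral_finsetSum _ fun t _ => (hmem t).integrable one_le_two] at hv
  simp only [h.integral_centred_mul] at hv
  simpa only [Finset.sum_sub_distrib] using hv

/-- Mean square of a sum of `N` consecutive values of a centred component. -/
theorem integral_sum_sq_le (h : IsMixingWithMoments P y S C) (k N : ℕ) (i : ι) :
    ∫ ω, (∑ t ∈ Finset.Icc 1 N, centred P y ((t : ℤ) + k) ω i) ^ 2 ∂P ≤
      N * (2 * ((16 * C + 1) * (k + 1 + S))) := by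
  have hmem : ∀ t : ℕ, MemLp (fun ω => centred P y ((t : ℤ) + k) ω i) 2 P := fun t =>
    (h.memLp_centred _ i).mono_exponent (by norm_num)
  have hv := variance_sum_le h.measurable h.psi_ne_top h.psi_sum_le k
    (fun t ω => centred P y ((t : ℤ) + k) ω i)
    (fun t => (measurable_pastSigma y le_rfl i).sub_const _)
    (fun t => (measurable_futureSigma y (by omega) i).sub_const _)
    hmem (fun t => h.integral_centred_sq_le _ i) N
  rw [variance_eq_integral
    (memLp_finsetSum _ fun t _ => hmem t).aestronglyMeasurable.aemeasurable,
    integral_finsetSum _ fun t _ => (hmem t).integrable one_le_two] at hv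
  simpa only [h.integral_centred, Finset.sum_const_zero, sub_zero] using hv

end IsMixingWithMoments

end Moments

/-! ### The error of the sample autocovariance matrices -/

section SampleCovariance

variable {Ω : Type*} [MeasurableSpace Ω] {P : Measure Ω} {r p : ℕ}

/-- The error of the sample autocovariance in terms of sums of the centred process. Only `n - k`
of the products are summed while the divisor is `n`, which accounts for the term
`k F.covY P k i j`. -/
theorem sampleCovY_sub_apply (F : FactorModel Ω r p) {n k : ℕ} (hn : 1 ≤ n) (hk : k ≤ n)
    (ω : Ω) (i j : Fin p) :
    n * (F.sampleCovY n ω k - F.covY P k) i j =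
      (∑ t ∈ Finset.Icc 1 (n - k), (centred P F.y ((t : ℤ) + k) ω i * centred P F.y t ω j -
        F.covY P k i j)) - k * F.covY P k i j
      - (∑ t ∈ Finset.Icc 1 n, centred P F.y t ω i) / n *
        (∑ t ∈ Finset.Icc 1 (n - k), centred P F.y t ω j)
      - (∑ t ∈ Finset.Icc 1 (n - k), centred P F.y ((t : ℤ) + k) ω i) *
        ((∑ t ∈ Finset.Icc 1 n, centred P F.y t ω j) / n)
      + ((n : ℝ) - k) * ((∑ t ∈ Finset.Icc 1 n, centred P F.y t ω i) / n) *
        ((∑ t ∈ Finset.Icc 1 n, centred P F.y t ω j) / n) := by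
  have hn0 : (n : ℝ) ≠ 0 := by positivity
  have hz : ∀ (t : ℤ) (l : Fin p), (F.y t ω - F.sampleMean n ω) l =
      centred P F.y t ω l - (∑ s ∈ Finset.Icc 1 n, centred P F.y s ω l) / n := by
    intro t l
    simp only [FactorModel.sampleMean, centred, Pi.sub_apply, Pi.smul_apply, Finset.sum_apply,
      smul_eq_mul, Finset.sum_sub_distrib, Finset.sum_const, Nat.card_Icc, nsmul_eq_mul]
    simp only [add_tsub_cancel_right]
    field_simp
    ring
  rw [Matrix.sub_apply, FactorModel.sampleCovY, Matrix.smul_apply, Matrix.sum_apply,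
    smul_eq_mul, mul_sub, mul_inv_cancel_left₀ hn0]
  simp only [Matrix.vecMulVec_apply, hz]
  generalize (∑ s ∈ Finset.Icc 1 n, centred P F.y s ω i) / (n : ℝ) = a
  generalize (∑ s ∈ Finset.Icc 1 n, centred P F.y s ω j) / (n : ℝ) = b
  simp only [sub_mul, mul_sub, Finset.sum_sub_distrib, Finset.sum_const, Nat.card_Icc,
    nsmul_eq_mul, add_tsub_cancel_right, ← Finset.sum_mul, ← Finset.mul_sum, Nat.cast_sub hk]
  ring

theorem sub_sub_sub_add_sq_le (a b c d e : ℝ) :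
    (a - b - c - d + e) ^ 2 ≤ 5 * (a ^ 2 + b ^ 2 + c ^ 2 + d ^ 2 + e ^ 2) := by
  nlinarith [sq_nonneg (a + b), sq_nonneg (a + c), sq_nonneg (a + d), sq_nonneg (a - e),
    sq_nonneg (b - c), sq_nonneg (b - d), sq_nonneg (b + e), sq_nonneg (c - d),
    sq_nonneg (c + e), sq_nonneg (d + e)]

/-- The spectral error is bounded by the Frobenius error, whose terms are sums of the squares of
the terms in `sampleCovY_sub_apply`. -/
theorem norm_sampleCovY_sub_sq_le_sum (F : FactorModel Ω r p) {n k : ℕ} (hn : 1 ≤ n)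
    (hk : k ≤ n) {D : ℝ} (hD : ∀ i j, |F.covY P k i j| ≤ D) (ω : Ω)
    {q : Fin p → Fin p → Ω → ℝ} {R A B : Fin p → Ω → ℝ}
    (hq : q = fun i j ω => ∑ t ∈ Finset.Icc 1 (n - k),
      (centred P F.y ((t : ℤ) + k) ω i * centred P F.y t ω j - F.covY P k i j))
    (hR : R = fun i ω => ∑ t ∈ Finset.Icc 1 n, centred P F.y t ω i)
    (hA : A = fun i ω => ∑ t ∈ Finset.Icc 1 (n - k), centred P F.y t ω i)
    (hB : B = fun i ω => ∑ t ∈ Finset.Icc 1 (n - k), centred P F.y ((t : ℤ) + k) ω i) :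
    ‖F.sampleCovY n ω k - F.covY P k‖ ^ 2 ≤
      5 / n ^ 2 * ((∑ i, ∑ j, q i j ω ^ 2) + p ^ 2 * (k ^ 2 * D ^ 2) +
        ((∑ i, R i ω ^ 2) * (∑ i, A i ω ^ 2) + (∑ i, B i ω ^ 2) * (∑ i, R i ω ^ 2) +
          (∑ i, R i ω ^ 2) * (∑ i, R i ω ^ 2)) / n ^ 2) := by
  have hn0 : (0 : ℝ) < n := by exact_mod_cast hn
  have entry : ∀ i j, (F.sampleCovY n ω k - F.covY P k) i j ^ 2 ≤
      5 / n ^ 2 * (q i j ω ^ 2 + k ^ 2 * D ^ 2 +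
        (R i ω ^ 2 * A j ω ^ 2 + B i ω ^ 2 * R j ω ^ 2 + R i ω ^ 2 * R j ω ^ 2) / n ^ 2) := by
    intro i j
    have e := sampleCovY_sub_apply (P := P) F hn hk ω i j
    replace e : n * (F.sampleCovY n ω k - F.covY P k) i j = q i j ω - k * F.covY P k i j - R i ω / n * A j ω - B i ω * (R j ω / n)
      + ((n : ℝ) - k) * (R i ω / n) * (R j ω / n) := by
      rw [e, hq, hR, hA, hB]
    have hc := abs_le.1 (hD i j)
    have hc2 : F.covY P k i j ^ 2 ≤ D ^ 2 := sq_le_sq' hc.1 hc.2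
    have h5 := sub_sub_sub_add_sq_le (q i j ω) (k * F.covY P k i j) (R i ω / n * A j ω) (B i ω * (R j ω / n))
      (((n : ℝ) - k) * (R i ω / n) * (R j ω / n))
    rw [← e] at h5
    have hkn : ((n : ℝ) - k) ^ 2 ≤ n ^ 2 := by
      have : (k : ℝ) ≤ n := by exact_mod_cast hk
      have : (0 : ℝ) ≤ k := by positivity
      nlinarith
    have hl : (((n : ℝ) - k) * (R i ω / n) * (R j ω / n)) ^ 2 ≤
        R i ω ^ 2 * R j ω ^ 2 / n ^ 2 := by
      calc (((n : ℝ) - k) * (R i ω / n) * (R j ω / n)) ^ 2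
          = ((n : ℝ) - k) ^ 2 * (R i ω ^ 2 * R j ω ^ 2 / n ^ 4) := by field_simp
        _ ≤ n ^ 2 * (R i ω ^ 2 * R j ω ^ 2 / n ^ 4) :=
            mul_le_mul_of_nonneg_right hkn (by positivity)
        _ = _ := by field_simp
    have hb : (k * F.covY P k i j) ^ 2 ≤ k ^ 2 * D ^ 2 := by
      rw [mul_pow]; exact mul_le_mul_of_nonneg_left hc2 (by positivity)
    rw [div_mul_eq_mul_div, le_div_iff₀ (by positivity)]
    calc (F.sampleCovY n ω k - F.covY P k) i j ^ 2 * n ^ 2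
        = (n * (F.sampleCovY n ω k - F.covY P k) i j) ^ 2 := by ring
      _ ≤ _ := h5
      _ ≤ 5 * (q i j ω ^ 2 + k ^ 2 * D ^ 2 + (R i ω / n * A j ω) ^ 2 +
          (B i ω * (R j ω / n)) ^ 2 + R i ω ^ 2 * R j ω ^ 2 / n ^ 2) := by linarith
      _ = _ := by field_simp; ring
  refine (norm_sq_le_sum_sq _).trans ?_
  refine (Finset.sum_le_sum fun i _ => Finset.sum_le_sum fun j _ => entry i j).trans ?_
  have total : ∑ i, ∑ j, 5 / (n : ℝ) ^ 2 * (q i j ω ^ 2 + k ^ 2 * D ^ 2 +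
        (R i ω ^ 2 * A j ω ^ 2 + B i ω ^ 2 * R j ω ^ 2 + R i ω ^ 2 * R j ω ^ 2) / n ^ 2) =
      5 / n ^ 2 * ((∑ i, ∑ j, q i j ω ^ 2) + p ^ 2 * (k ^ 2 * D ^ 2) +
        ((∑ i, R i ω ^ 2) * (∑ i, A i ω ^ 2) + (∑ i, B i ω ^ 2) * (∑ i, R i ω ^ 2) + (∑ i, R i ω ^ 2) * (∑ i, R i ω ^ 2)) / n ^ 2) := by
    simp only [← Finset.mul_sum, Finset.sum_add_distrib, ← Finset.sum_div,
      Finset.sum_mul_sum, Finset.sum_const, Finset.card_univ, Fintype.card_fin, nsmul_eq_mul]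
    ring
  exact total.le

/-- The bound of `norm_sampleCovY_sub_sq_le_sum` in terms of the normalised sums of squares; the
normalisation is such that each has bounded mean. -/
theorem error_sum_le {n p Q R A B K : ℝ} (hn1 : 1 ≤ n) (hp1 : 1 ≤ p) (zq : 0 ≤ Q)
    (zR : 0 ≤ R) (zA : 0 ≤ A) (zB : 0 ≤ B) (hK : 0 ≤ K) :
    5 / n ^ 2 * (Q + p ^ 2 * K + (R * A + B * R + R * R) / n ^ 2) ≤
      5 * ((Q / (n * p ^ 2) + (R + A + B) / (n * p)) + K +
        3 * (Q / (n * p ^ 2) + (R + A + B) / (n * p)) ^ 2) * (p ^ 2 * n⁻¹) := by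
  have hn0 : 0 < n := by linarith
  have hp0 : 0 < p := by linarith
  set Z := Q / (n * p ^ 2) + (R + A + B) / (n * p) with hZ
  have hZq : Q ≤ Z * n * p ^ 2 := by
    have : Q / (n * p ^ 2) ≤ Z := le_add_of_nonneg_right (by positivity)
    rw [div_le_iff₀ (by positivity)] at this; linarith
  have hZs : R + A + B ≤ Z * (n * p) := by
    have : (R + A + B) / (n * p) ≤ Z := le_add_of_nonneg_left (by positivity)
    rwa [div_le_iff₀ (by positivity)] at this
  have hZ0 : 0 ≤ Z := by positivity
  have hprod : R * A + B * R + R * R ≤ 3 * (Z * (n * p)) ^ 2 := by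
    have b1 : R ≤ Z * (n * p) := by linarith
    have b2 : A ≤ Z * (n * p) := by linarith
    have b3 : B ≤ Z * (n * p) := by linarith
    have m1 := mul_le_mul b1 b2 zA (zR.trans b1)
    have m2 := mul_le_mul b3 b1 zR (zR.trans b1)
    have m3 := mul_le_mul b1 b1 zR (zR.trans b1)
    linarith
  calc 5 / n ^ 2 * (Q + p ^ 2 * K +
        (R * A + B * R + R * R) / n ^ 2)
      ≤ 5 / n ^ 2 * (Z * n * p ^ 2 + p ^ 2 * K +
        3 * (Z * (n * p)) ^ 2 / n ^ 2) := by gcongr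
    _ = 5 * p ^ 2 / n ^ 2 * (n * Z + K + 3 * Z ^ 2) := by
        field_simp
    _ ≤ 5 * p ^ 2 / n ^ 2 *
        (n * Z + n * K + n * (3 * Z ^ 2)) := by
        exact mul_le_mul_of_nonneg_left (add_le_add (add_le_add le_rfl
          (le_mul_of_one_le_left hK hn1)) (le_mul_of_one_le_left (by positivity) hn1))
          (by positivity)
    _ = _ := by field_simp

/-- Up to the probabilistic factor `Z`, bounded in mean, the squared error of the sample
autocovariance matrix is `p² / n`. Centring at the sample mean contributes products of two sums
of the centred process; only the square root of each such product is controlled in mean, and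
this is why `Z ^ 2` occurs. -/
theorem exists_norm_sampleCovY_sub_sq_le [IsProbabilityMeasure P] (F : FactorModel Ω r p)
    {S : ℝ} {C : ℝ≥0} (h : IsMixingWithMoments P F.y S C) {n k : ℕ} (hn : 1 ≤ n) (hk : k ≤ n)
    (hp : 1 ≤ p) :
    ∃ Z : Ω → ℝ, 0 ≤ Z ∧ Integrable Z P ∧
      ∫ ω, Z ω ∂P ≤ 4 * (2 * ((16 * C + 1) * (k + 1 + S))) ∧
      ∀ ω, ‖F.sampleCovY n ω k - F.covY P k‖ ^ 2 ≤
        5 * (Z ω + k ^ 2 * (16 * C + 1) ^ 2 + 3 * Z ω ^ 2) * ((p : ℝ) ^ 2 * (n : ℝ)⁻¹) := by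
  set V : ℝ := 2 * ((16 * C + 1) * (k + 1 + S)) with hV
  have hn1 : (1 : ℝ) ≤ n := by exact_mod_cast hn
  have hp1 : (1 : ℝ) ≤ p := by exact_mod_cast hp
  have hS : 0 ≤ S := by simpa using h.psi_sum_le 0
  have hV0 : 0 ≤ V := by positivity
  have hNn : ((n - k : ℕ) : ℝ) ≤ n := by exact_mod_cast Nat.sub_le n k
  set q : Fin p → Fin p → Ω → ℝ := fun i j ω => ∑ t ∈ Finset.Icc 1 (n - k),
    (centred P F.y ((t : ℤ) + k) ω i * centred P F.y t ω j - F.covY P k i j) with hq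
  set R : Fin p → Ω → ℝ := fun i ω => ∑ t ∈ Finset.Icc 1 n, centred P F.y t ω i with hR
  set A : Fin p → Ω → ℝ := fun i ω => ∑ t ∈ Finset.Icc 1 (n - k), centred P F.y t ω i with hA
  set B : Fin p → Ω → ℝ :=
    fun i ω => ∑ t ∈ Finset.Icc 1 (n - k), centred P F.y ((t : ℤ) + k) ω i with hB
  have c2 : ∀ (t : ℤ) i, MemLp (fun ω => centred P F.y t ω i) 2 P := fun t i =>
    (h.memLp_centred t i).mono_exponent (by norm_num)
  have mq : ∀ i j, Integrable (fun ω => q i j ω ^ 2) P := fun i j =>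
    (memLp_finsetSum _ fun t _ => (memLp_two_mul (h.memLp_centred _ i)
      (h.memLp_centred _ j)).sub (memLp_const _)).integrable_sq
  have mR : ∀ i, Integrable (fun ω => R i ω ^ 2) P := fun i =>
    (memLp_finsetSum _ fun t _ => c2 _ i).integrable_sq
  have mA : ∀ i, Integrable (fun ω => A i ω ^ 2) P := fun i =>
    (memLp_finsetSum _ fun t _ => c2 _ i).integrable_sq
  have mB : ∀ i, Integrable (fun ω => B i ω ^ 2) P := fun i =>
    (memLp_finsetSum _ fun t _ => c2 _ i).integrable_sq
  have eq : ∀ i j, ∫ ω, q i j ω ^ 2 ∂P ≤ n * V := fun i j =>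
    (h.integral_sum_mul_sq_le k (n - k) i j).trans (mul_le_mul_of_nonneg_right hNn hV0)
  have hV' : 2 * ((16 * (C : ℝ) + 1) * (((0 : ℕ) : ℝ) + 1 + S)) ≤ V := by
    rw [hV]; push_cast; gcongr; positivity
  have eR : ∀ i, ∫ ω, R i ω ^ 2 ∂P ≤ n * V := fun i => by
    have := h.integral_sum_sq_le 0 n i
    simp only [Nat.cast_zero, add_zero] at this
    exact this.trans (by simpa using mul_le_mul_of_nonneg_left hV' (by positivity))
  have eA : ∀ i, ∫ ω, A i ω ^ 2 ∂P ≤ n * V := fun i => by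
    have := h.integral_sum_sq_le 0 (n - k) i
    simp only [Nat.cast_zero, add_zero] at this
    exact this.trans (mul_le_mul hNn (by simpa using hV') (by positivity) (by positivity))
  have eB : ∀ i, ∫ ω, B i ω ^ 2 ∂P ≤ n * V := fun i =>
    (h.integral_sum_sq_le k (n - k) i).trans (mul_le_mul_of_nonneg_right hNn hV0)
  set sq' : Ω → ℝ := fun ω => ∑ i, ∑ j, q i j ω ^ 2 with hsq
  set sR : Ω → ℝ := fun ω => ∑ i, R i ω ^ 2 with hsR
  set sA : Ω → ℝ := fun ω => ∑ i, A i ω ^ 2 with hsA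
  set sB : Ω → ℝ := fun ω => ∑ i, B i ω ^ 2 with hsB
  have nq : ∀ ω, 0 ≤ sq' ω := fun ω =>
    Finset.sum_nonneg fun i _ => Finset.sum_nonneg fun j _ => sq_nonneg _
  have nR : ∀ ω, 0 ≤ sR ω := fun ω => Finset.sum_nonneg fun i _ => sq_nonneg _
  have nA : ∀ ω, 0 ≤ sA ω := fun ω => Finset.sum_nonneg fun i _ => sq_nonneg _
  have nB : ∀ ω, 0 ≤ sB ω := fun ω => Finset.sum_nonneg fun i _ => sq_nonneg _
  have iq : Integrable sq' P :=
    integrable_finsetSum _ fun i _ => integrable_finsetSum _ fun j _ => mq i j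
  have iR : Integrable sR P := integrable_finsetSum _ fun i _ => mR i
  have iA : Integrable sA P := integrable_finsetSum _ fun i _ => mA i
  have iB : Integrable sB P := integrable_finsetSum _ fun i _ => mB i
  have bnd : ∀ G : Fin p → Ω → ℝ, (∀ i, Integrable (fun ω => G i ω ^ 2) P) →
      (∀ i, ∫ ω, G i ω ^ 2 ∂P ≤ n * V) → ∫ ω, ∑ i, G i ω ^ 2 ∂P ≤ p * (n * V) := by
    intro G hG hG'
    rw [integral_finsetSum _ fun i _ => hG i]
    exact (Finset.sum_le_sum fun i _ => hG' i).trans (by simp)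
  have Iq : ∫ ω, sq' ω ∂P ≤ p ^ 2 * (n * V) := by
    rw [hsq, integral_finsetSum _ fun i _ => integrable_finsetSum _ fun j _ => mq i j]
    refine (Finset.sum_le_sum fun i _ => bnd (q i) (mq i) (eq i)).trans ?_
    simp only [Finset.sum_const, Finset.card_univ, Fintype.card_fin, nsmul_eq_mul]
    exact le_of_eq (by ring)
  refine ⟨fun ω => sq' ω / (n * p ^ 2) + (sR ω + sA ω + sB ω) / (n * p), fun ω => ?_, ?_, ?_,
    fun ω => ?_⟩
  · exact add_nonneg (div_nonneg (nq ω) (by positivity))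
      (div_nonneg (add_nonneg (add_nonneg (nR ω) (nA ω)) (nB ω)) (by positivity))
  · exact (iq.div_const _).add (((iR.add iA).add iB).div_const _)
  · have i₁ : Integrable (fun ω => sR ω + sA ω) P := iR.add iA
    have i₂ : Integrable (fun ω => sR ω + sA ω + sB ω) P := i₁.add iB
    rw [integral_add (iq.div_const _) (i₂.div_const _), integral_div, integral_div,
      integral_add i₁ iB, integral_add iR iA]
    have h1 : (∫ ω, sq' ω ∂P) / (n * p ^ 2) ≤ V := by
      rw [div_le_iff₀ (by positivity)]; linarith
    have h2 : ((∫ ω, sR ω ∂P) + (∫ ω, sA ω ∂P) + ∫ ω, sB ω ∂P) / (n * p) ≤ 3 * V := by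
      rw [div_le_iff₀ (by positivity)]
      have := bnd R mR eR; have := bnd A mA eA; have := bnd B mB eB
      linarith
    linarith
  · exact (norm_sampleCovY_sub_sq_le_sum F hn hk (h.abs_crossCov_le k) ω hq hR hA hB).trans
      (error_sum_le hn1 hp1 (nq ω) (nR ω) (nA ω) (nB ω) (by positivity))

end SampleCovariance

/-! ### The population autocovariances -/

section Population

variable {Ω : Type*} [MeasurableSpace Ω] {P : Measure Ω} [IsProbabilityMeasure P] {r p : ℕ}

/-- `Σ_y(k) = A (Σ_x(k) Aᵀ + Σ_{xε}(k))` at positive lags: the noise is uncorrelated with its own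
past and with the past of the factors. -/
theorem FactorModel.covY_eq (F : FactorModel Ω r p) (h1 : F.IsIdentified P)
    (h2 : F.FutureNoiseUncorrelated P) {k : ℕ} (hk : 1 ≤ k) :
    F.covY P k = F.A * (F.covX P k * F.Aᵀ + F.covXNoise P k) := by
  obtain ⟨m, S, hε⟩ := h1.noise
  have hx := h2.stationary.memLp
  have hsum : ∀ (t : ℤ) (i : Fin p), MemLp (fun ω => ∑ a, F.A i a * F.x t ω a) 2 P :=
    fun t i => memLp_finsetSum _ fun a _ => (hx t a).const_mul _
  ext i j
  have hy : ∀ (t : ℤ) (l : Fin p),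
      (fun ω => F.y t ω l) = (fun ω => ∑ a, F.A l a * F.x t ω a) + fun ω => F.ε t ω l := by
    intro t l
    rfl
  have hεε : covariance (fun ω => F.ε k ω i) (fun ω => F.ε 0 ω j) P = 0 := by
    have := congrFun (congrFun (hε.uncorrelated k 0 (by omega)) i) j
    simpa [crossCov] using this
  have hεx : ∀ b, covariance (fun ω => F.ε k ω i) (fun ω => F.x 0 ω b) P = 0 := by
    intro b
    have := congrFun (congrFun (h2.uncorrelated 0 k) b) i
    rw [covariance_comm]
    simpa [crossCov] using this
  rw [FactorModel.covY, crossCov, Matrix.of_apply, hy, hy,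
    covariance_add_left (hsum _ _) (hε.memLp _ _) ((hsum _ _).add (hε.memLp _ _)),
    covariance_add_right (hsum _ _) (hsum _ _) (hε.memLp _ _),
    covariance_add_right (hε.memLp _ _) (hsum _ _) (hε.memLp _ _), hεε,
    covariance_fun_sum_fun_sum (fun a => (hx _ a).const_mul _) (fun b => (hx _ b).const_mul _),
    covariance_fun_sum_left (fun a => (hx _ a).const_mul _) (hε.memLp _ _),
    covariance_fun_sum_right (fun b => (hx _ b).const_mul _) (hε.memLp _ _)]
  simp only [covariance_const_mul_left, covariance_const_mul_right, hεx, mul_zero,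
    Finset.sum_const_zero, add_zero]
  rw [Matrix.mul_add, Matrix.add_apply]
  simp only [Matrix.mul_apply, Matrix.transpose_apply, FactorModel.covX, FactorModel.covXNoise,
    crossCov, Matrix.of_apply, Finset.mul_sum]
  congr 1
  refine Finset.sum_congr rfl fun a _ => Finset.sum_congr rfl fun b _ => ?_
  ring

theorem norm_le_one_of_transpose_mul_self {A : Matrix (Fin p) (Fin r) ℝ} (hA : Aᵀ * A = 1) :
    ‖A‖ ≤ 1 := by
  have h := Matrix.l2_opNorm_conjTranspose_mul_self A
  rw [Matrix.conjTranspose_eq_transpose_of_trivial, hA] at h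
  have h1 : ‖(1 : Matrix (Fin r) (Fin r) ℝ)‖ ≤ 1 := by
    rw [← Matrix.diagonal_one, Matrix.l2_opNorm_diagonal]
    exact (pi_norm_le_iff_of_nonneg zero_le_one).2 fun i => by simp
  nlinarith [norm_nonneg A]

theorem FactorModel.norm_covY_le (F : FactorModel Ω r p) (h1 : F.IsIdentified P)
    (h2 : F.FutureNoiseUncorrelated P) {k : ℕ} (hk : 1 ≤ k) :
    ‖F.covY P k‖ ≤ ‖F.covX P k‖ + ‖F.covXNoise P k‖ := by
  have hA := norm_le_one_of_transpose_mul_self h1.orthonormal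
  have hA' : ‖F.Aᵀ‖ ≤ 1 := by rwa [norm_transpose_eq]
  rw [F.covY_eq h1 h2 hk]
  calc ‖F.A * (F.covX P k * F.Aᵀ + F.covXNoise P k)‖
      ≤ ‖F.A‖ * ‖F.covX P k * F.Aᵀ + F.covXNoise P k‖ := Matrix.l2_opNorm_mul _ _
    _ ≤ 1 * ‖F.covX P k * F.Aᵀ + F.covXNoise P k‖ := by gcongr
    _ ≤ ‖F.covX P k * F.Aᵀ‖ + ‖F.covXNoise P k‖ := by rw [one_mul]; exact norm_add_le _ _
    _ ≤ ‖F.covX P k‖ * ‖F.Aᵀ‖ + ‖F.covXNoise P k‖ := by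
        gcongr; exact Matrix.l2_opNorm_mul _ _
    _ ≤ ‖F.covX P k‖ * 1 + ‖F.covXNoise P k‖ := by gcongr
    _ = _ := by rw [mul_one]

theorem FactorModel.measurable_y (F : FactorModel Ω r p) (t : ℤ) : Measurable (F.y t) := by
  refine measurable_pi_lambda _ fun i => ?_
  have hx : ∀ a, Measurable fun ω => F.x t ω a := fun a =>
    (measurable_pi_apply a).comp (F.measurable_x t)
  have hε : Measurable fun ω => F.ε t ω i := (measurable_pi_apply i).comp (F.measurable_ε t)
  change Measurable fun ω => (∑ a, F.A i a * F.x t ω a) + F.ε t ω i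
  fun_prop

end Population

/-! ### Rates along the sequence of models -/

section Rates

variable {Ω : ℕ → Type*} [∀ n, MeasurableSpace (Ω n)] {P : ∀ n, Measure (Ω n)} {r : ℕ}
  {p : ℕ → ℕ} {F : ∀ n, FactorModel (Ω n) r (p n)}

/-- `∑ t ψ(t)^{1/2} ≤ C` bounds each `ψ(t)^{1/2}` by `C`, hence `∑ ψ(t)` by `C²`. -/
theorem MixingMoments.exists_isMixingWithMoments (h : MixingMoments P F) :
    ∃ (S : ℝ) (C : ℝ≥0), ∀ n, IsMixingWithMoments (P n) (F n).y S C := by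
  obtain ⟨c, hc⟩ := h.mixing
  obtain ⟨C, hC⟩ := h.moments
  refine ⟨(c * c : ℝ≥0), C, fun n => ?_⟩
  set ψ := psiCoeff (P n) (F n).y with hψ
  have hsq : ∀ e : ℕ, ψ (e + 1) = ψ (e + 1) ^ (1 / 2 : ℝ) * ψ (e + 1) ^ (1 / 2 : ℝ) := by
    intro e
    rw [← ENNReal.rpow_add_of_nonneg _ _ (by norm_num) (by norm_num)]
    norm_num
  -- The weight `t` in the hypothesis is at least `1` at positive lags.
  have hle : ∀ e : ℕ, ψ (e + 1) ^ (1 / 2 : ℝ) ≤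
      ((e + 1 : ℕ) : ℝ≥0∞) * ψ (e + 1) ^ (1 / 2 : ℝ) := fun e =>
    le_mul_of_one_le_left zero_le (by exact_mod_cast Nat.le_add_left 1 e)
  have hterm : ∀ e : ℕ, ψ (e + 1) ^ (1 / 2 : ℝ) ≤ c := fun e =>
    (hle e).trans ((ENNReal.le_tsum (f := fun t : ℕ => (t : ℝ≥0∞) * ψ t ^ (1 / 2 : ℝ))
      (e + 1)).trans (hc n))
  have hfin : ∀ e : ℕ, ψ (e + 1) ≠ ∞ := by
    intro e
    rw [hsq e]
    exact ne_top_of_le_ne_top (ENNReal.mul_ne_top ENNReal.coe_ne_top ENNReal.coe_ne_top)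
      (mul_le_mul' (hterm e) (hterm e))
  have hsum : ∀ N : ℕ, ∑ e ∈ Finset.range N, ψ (e + 1) ≤ ((c * c : ℝ≥0) : ℝ≥0∞) := by
    intro N
    have hpart : ∑ e ∈ Finset.range N, ((e + 1 : ℕ) : ℝ≥0∞) * ψ (e + 1) ^ (1 / 2 : ℝ) ≤ c := by
      refine le_trans ?_ (hc n)
      refine le_trans ?_ (ENNReal.sum_le_tsum (Finset.range (N + 1)))
      rw [Finset.sum_range_succ']
      exact le_self_add
    calc ∑ e ∈ Finset.range N, ψ (e + 1)
        ≤ ∑ e ∈ Finset.range N, c * (((e + 1 : ℕ) : ℝ≥0∞) * ψ (e + 1) ^ (1 / 2 : ℝ)) := by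
          refine Finset.sum_le_sum fun e _ => ?_
          conv_lhs => rw [hsq e]
          exact mul_le_mul' (hterm e) (hle e)
      _ = c * ∑ e ∈ Finset.range N, ((e + 1 : ℕ) : ℝ≥0∞) * ψ (e + 1) ^ (1 / 2 : ℝ) := by
          rw [Finset.mul_sum]
      _ ≤ c * c := by gcongr
      _ = _ := by push_cast; rfl
  refine ⟨(F n).measurable_y, h.stationary n, hfin, fun N => ?_, hC n⟩
  rw [← ENNReal.toReal_sum fun e _ => hfin e]
  exact ENNReal.toReal_le_coe_of_le_coe (hsum N)

variable [∀ n, IsProbabilityMeasure (P n)]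

theorem isBigOP_norm_sampleCovY_sub_sq (hp : Tendsto p atTop atTop) (h3 : MixingMoments P F)
    (k : ℕ) :
    IsBigOP P (fun n ω => ‖(F n).sampleCovY n ω k - (F n).covY (P n) k‖ ^ 2)
      (fun n => (p n : ℝ) ^ 2 * (n : ℝ)⁻¹) := by
  obtain ⟨S, C, hS⟩ := h3.exists_isMixingWithMoments
  have hS0 : 0 ≤ S := by simpa using (hS 0).psi_sum_le 0
  intro η hη
  set V : ℝ := 4 * (2 * ((16 * C + 1) * (k + 1 + S))) with hV
  have hV0 : 0 < V := by positivity
  set K : ℝ := V / η with hK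
  have hK0 : 0 < K := by positivity
  refine ⟨5 * (K + k ^ 2 * (16 * C + 1) ^ 2 + 3 * K ^ 2), by positivity, ?_⟩
  filter_upwards [eventually_ge_atTop 1, eventually_ge_atTop k,
    hp.eventually (eventually_ge_atTop 1)] with n hn hk hpn
  obtain ⟨Z, hZ0, hZi, hZV, hZ⟩ := exists_norm_sampleCovY_sub_sq_le (F n) (hS n) hn hk hpn
  have hmarkov := mul_meas_ge_le_integral_of_nonneg (ae_of_all _ hZ0) hZi K
  have hprob : (P n).real {ω | K ≤ Z ω} ≤ η := by
    have h1 : K * (P n).real {ω | K ≤ Z ω} ≤ V := hmarkov.trans hZV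
    have h2 : V = K * η := by rw [hK]; field_simp
    rw [h2] at h1
    exact le_of_mul_le_mul_left h1 hK0
  have hsub : {ω | 5 * (K + k ^ 2 * (16 * C + 1) ^ 2 + 3 * K ^ 2) * ((p n : ℝ) ^ 2 * (n : ℝ)⁻¹) <
      |‖(F n).sampleCovY n ω k - (F n).covY (P n) k‖ ^ 2|} ⊆ {ω | K ≤ Z ω} := by
    intro ω hω
    simp only [Set.mem_ofPred_eq] at hω ⊢
    by_contra! hlt
    rw [abs_of_nonneg (sq_nonneg _)] at hω
    refine absurd (hω.trans_le (hZ ω)) (not_lt.2 ?_)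
    have := hZ0 ω
    simp only [Pi.zero_apply] at this
    gcongr
  refine (measure_mono hsub).trans ?_
  rw [← ofReal_measureReal]
  exact ENNReal.ofReal_le_ofReal hprob

/-- The errors at all lags `1, …, k₀` are controlled on one event. -/
theorem exists_prob_norm_sampleCovY_sub_sq_le (hp : Tendsto p atTop atTop)
    (h3 : MixingMoments P F) (k₀ : ℕ) {η : ℝ} (hη : 0 < η) :
    ∃ K : ℝ, 0 < K ∧ ∀ᶠ n in atTop, P n {ω | ∃ k ∈ Finset.Icc 1 k₀,
      K * ((p n : ℝ) ^ 2 * (n : ℝ)⁻¹) < ‖(F n).sampleCovY n ω k - (F n).covY (P n) k‖ ^ 2} ≤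
        ENNReal.ofReal η := by
  have hη' : 0 < η / (k₀ + 1) := by positivity
  choose c hc0 hc using fun k => isBigOP_norm_sampleCovY_sub_sq hp h3 k (η / (k₀ + 1)) hη'
  have hs0 : 0 ≤ ∑ k ∈ Finset.Icc 1 k₀, c k := Finset.sum_nonneg fun k _ => (hc0 k).le
  refine ⟨∑ k ∈ Finset.Icc 1 k₀, c k + 1, by positivity, ?_⟩
  have hall := (Filter.eventually_all_finset (Finset.Icc 1 k₀)).2 fun k _ => hc k
  filter_upwards [hall] with n hn
  calc P n {ω | ∃ k ∈ Finset.Icc 1 k₀, (∑ k ∈ Finset.Icc 1 k₀, c k + 1) *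
        ((p n : ℝ) ^ 2 * (n : ℝ)⁻¹) < ‖(F n).sampleCovY n ω k - (F n).covY (P n) k‖ ^ 2}
      ≤ P n (⋃ k ∈ Finset.Icc 1 k₀, {ω | c k * ((p n : ℝ) ^ 2 * (n : ℝ)⁻¹) <
          |‖(F n).sampleCovY n ω k - (F n).covY (P n) k‖ ^ 2|}) := by
        refine measure_mono fun ω hω => ?_
        obtain ⟨k, hk, hlt⟩ := hω
        refine Set.mem_iUnion₂.2 ⟨k, hk, ?_⟩
        rw [Set.mem_ofPred_eq, abs_of_nonneg (sq_nonneg _)]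
        refine lt_of_le_of_lt (mul_le_mul_of_nonneg_right ?_ (by positivity)) hlt
        have := Finset.single_le_sum (fun k _ => (hc0 k).le) hk
        linarith
    _ ≤ ∑ k ∈ Finset.Icc 1 k₀, ENNReal.ofReal (η / (k₀ + 1)) :=
        (measure_biUnion_finset_le _ _).trans (Finset.sum_le_sum hn)
    _ ≤ ENNReal.ofReal η := by
        rw [← ENNReal.ofReal_sum_of_nonneg fun _ _ => hη'.le]
        refine ENNReal.ofReal_le_ofReal ?_
        simp only [Finset.sum_const, Nat.card_Icc, add_tsub_cancel_right, nsmul_eq_mul]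
        rw [mul_div_assoc', div_le_iff₀ (by positivity)]
        nlinarith

theorem exists_norm_covY_le {k₀ : ℕ} {δ : ℝ} (h1 : ∀ n, (F n).IsIdentified (P n))
    (h2 : ∀ n, (F n).FutureNoiseUncorrelated (P n)) (h5 : FactorStrength P F k₀ δ)
    (h6 : WeakCrossCov P F k₀ δ) :
    ∃ B : ℝ, 0 ≤ B ∧ ∀ᶠ n in atTop, ∀ k ∈ Finset.Icc 1 k₀,
      ‖(F n).covY (P n) k‖ ≤ B * (p n : ℝ) ^ (1 - δ) := by
  have hk : ∀ k : ℕ, ∃ b : ℝ, 0 ≤ b ∧ (k ∈ Finset.Icc 1 k₀ → ∀ᶠ n in atTop,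
      ‖(F n).covY (P n) k‖ ≤ b * (p n : ℝ) ^ (1 - δ)) := by
    intro k
    by_cases hk : k ∈ Finset.Icc 1 k₀
    · have hk' := Finset.mem_Icc.1 hk
      have hO := (h5 k hk).1.isBigO.add
        (h6 k (Finset.mem_range.2 (by omega))).isBigO
      obtain ⟨b, hb0, hb⟩ := hO.exists_nonneg
      refine ⟨b, hb0, fun _ => ?_⟩
      filter_upwards [hb.bound] with n hn
      rw [Real.norm_of_nonneg (by positivity), Real.norm_of_nonneg (by positivity)] at hn
      exact ((F n).norm_covY_le (h1 n) (h2 n) hk'.1).trans hn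
    · exact ⟨0, le_rfl, fun h => absurd h hk⟩
  choose b hb0 hb using hk
  refine ⟨∑ k ∈ Finset.Icc 1 k₀, b k, Finset.sum_nonneg fun k _ => hb0 k, ?_⟩
  filter_upwards [(Filter.eventually_all_finset (Finset.Icc 1 k₀)).2 hb] with n hn k hk
  refine (hn k hk).trans (mul_le_mul_of_nonneg_right ?_ (by positivity))
  exact Finset.single_le_sum (fun k _ => hb0 k) hk

theorem sq_mul_inv_eq_mul_rpow {a b : ℝ} (ha : 0 < a) (hb : 0 < b) (δ : ℝ) :
    a ^ 2 * b⁻¹ = a ^ δ * b ^ (-(1 / 2) : ℝ) * (a ^ (2 - δ) * b ^ (-(1 / 2) : ℝ)) := by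
  have e1 : a ^ δ * a ^ (2 - δ) = a ^ 2 := by
    rw [← Real.rpow_add ha, add_sub_cancel]; exact_mod_cast Real.rpow_natCast a 2
  have e2 : b ^ (-(1 / 2) : ℝ) * b ^ (-(1 / 2) : ℝ) = b⁻¹ := by
    rw [← Real.rpow_add hb, show (-(1 / 2) : ℝ) + -(1 / 2) = -1 by norm_num, Real.rpow_neg_one]
  rw [← e1, ← e2]; ring

end Rates

end FactorSeries

/-! ### Rates of the eigenvalues -/

open FactorSeries in
theorem theorem1 {Ω : ℕ → Type*} [∀ n, MeasurableSpace (Ω n)]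
    (P : ∀ n, Measure (Ω n)) [∀ n, IsProbabilityMeasure (P n)]
    (r k₀ : ℕ) (hk₀ : 1 ≤ k₀) (δ : ℝ) (hδ : δ ∈ Set.Icc (0 : ℝ) 1)
    (p : ℕ → ℕ) (hp : Tendsto p atTop atTop)
    (F : ∀ n, FactorSeries.FactorModel (Ω n) r (p n))
    (h1 : ∀ n, (F n).IsIdentified (P n))
    (h2 : ∀ n, (F n).FutureNoiseUncorrelated (P n))
    (h3 : FactorSeries.MixingMoments P F)
    (h4 : ∀ n, (F n).DistinctEig (P n) k₀)
    (h5 : FactorSeries.FactorStrength P F k₀ δ)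
    (h6 : FactorSeries.WeakCrossCov P F k₀ δ)
    (hh : Tendsto (fun n : ℕ => (p n : ℝ) ^ δ * (n : ℝ) ^ (-(1 / 2) : ℝ)) atTop (𝓝 0)) :
    (∀ i < r, FactorSeries.IsBigOP P
      (fun n ω => (F n).eigHat k₀ n i ω - (F n).eig (P n) k₀ i)
      (fun n => (p n : ℝ) ^ (2 - δ) * (n : ℝ) ^ (-(1 / 2) : ℝ))) ∧
    FactorSeries.IsBigOPUniform P (fun n => Set.Ico r (p n))
      (fun n j ω => (F n).eigHat k₀ n j ω)
      (fun n => (p n : ℝ) ^ 2 * (n : ℝ)⁻¹) ∧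
    (fun n : ℕ => (p n : ℝ) ^ 2 * (n : ℝ)⁻¹) =o[atTop]
      (fun n : ℕ => (p n : ℝ) ^ (2 - δ) * (n : ℝ) ^ (-(1 / 2) : ℝ)) := by
  have hpos : ∀ᶠ n : ℕ in atTop, (0 : ℝ) < p n ∧ (0 : ℝ) < n := by
    filter_upwards [hp.eventually (eventually_gt_atTop 0), eventually_gt_atTop 0] with n h h'
    exact ⟨by exact_mod_cast h, by exact_mod_cast h'⟩
  refine ⟨fun i _ η hη => ?_, fun η hη => ?_, ?_⟩
  · obtain ⟨K, hK0, hK⟩ := exists_prob_norm_sampleCovY_sub_sq_le hp h3 k₀ hη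
    obtain ⟨B, hB0, hB⟩ := exists_norm_covY_le h1 h2 h5 h6
    have hC0 : 0 < 2 * B * √K + K := by positivity
    have hk0' : (0 : ℝ) < k₀ := by exact_mod_cast hk₀
    refine ⟨k₀ * (2 * B * √K + K), by positivity, ?_⟩
    filter_upwards [hK, hB, hpos, hh.eventually_le_const one_pos] with n hKn hBn hn hh1
    -- Off the event of `hKn` every lag has an error of order `p n^{-1/2}`.
    refine (measure_mono fun ω hω => ?_).trans hKn
    simp only [Set.mem_ofPred_eq] at hω ⊢
    by_contra! hall
    refine absurd hω (not_lt.2 ?_)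
    refine (abs_sortedEig_sub_le _ _ i).trans ((norm_lagSum_sub_le _ _ k₀).trans ?_)
    rw [mul_assoc, ← nsmul_eq_mul]
    refine (Finset.sum_le_card_nsmul _ _ _ fun k hk => ?_).trans
      (le_of_eq (by rw [Nat.card_Icc, add_tsub_cancel_right]))
    set a : ℝ := (p n : ℝ) ^ (2 - δ) * (n : ℝ) ^ (-(1 / 2) : ℝ) with ha
    -- The squared error is of smaller order because `p^δ n^{-1/2} ≤ 1` eventually.
    have hrate : (p n : ℝ) ^ 2 * (n : ℝ)⁻¹ ≤ a := by
      rw [sq_mul_inv_eq_mul_rpow hn.1 hn.2 δ]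
      exact mul_le_of_le_one_left (by positivity) hh1
    have hsqrt : ‖(F n).sampleCovY n ω k - (F n).covY (P n) k‖ ≤
        √K * ((p n : ℝ) * (n : ℝ) ^ (-(1 / 2) : ℝ)) := by
      refine (pow_le_pow_iff_left₀ (norm_nonneg _) (by positivity) two_ne_zero).1
        ((hall k hk).trans (le_of_eq ?_))
      rw [mul_pow, mul_pow, Real.sq_sqrt hK0.le, ← Real.rpow_natCast (_ ^ (-(1 / 2) : ℝ)),
        ← Real.rpow_mul hn.2.le]
      norm_num [Real.rpow_neg_one]
    have ha' : (p n : ℝ) ^ (1 - δ) * ((p n : ℝ) * (n : ℝ) ^ (-(1 / 2) : ℝ)) = a := by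
      rw [ha, ← mul_assoc, ← Real.rpow_add_one hn.1.ne']
      ring_nf
    calc 2 * ‖(F n).covY (P n) k‖ * ‖(F n).sampleCovY n ω k - (F n).covY (P n) k‖ +
          ‖(F n).sampleCovY n ω k - (F n).covY (P n) k‖ ^ 2
        ≤ 2 * (B * (p n : ℝ) ^ (1 - δ)) * (√K * ((p n : ℝ) * (n : ℝ) ^ (-(1 / 2) : ℝ))) +
          K * a := by
          have := hBn k hk
          have := (hall k hk).trans (mul_le_mul_of_nonneg_left hrate hK0.le)
          gcongr
      _ = 2 * B * √K * ((p n : ℝ) ^ (1 - δ) * ((p n : ℝ) * (n : ℝ) ^ (-(1 / 2) : ℝ))) +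
          K * a := by ring
      _ = _ := by rw [ha']; ring
  · obtain ⟨K, hK0, hK⟩ := exists_prob_norm_sampleCovY_sub_sq_le hp h3 k₀ hη
    have hk0' : (0 : ℝ) < k₀ := by exact_mod_cast hk₀
    refine ⟨k₀ * K, by positivity, ?_⟩
    filter_upwards [hK] with n hKn
    refine (measure_mono fun ω hω => ?_).trans hKn
    simp only [Set.mem_ofPred_eq] at hω ⊢
    by_contra! hall
    obtain ⟨j, hj, hlt⟩ := hω
    refine absurd hlt (not_lt.2 ?_)
    rw [FactorModel.eigHat, abs_of_nonneg (sortedEig_nonneg (lagSum_posSemidef _ _) j)]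
    refine (sortedEig_lagSum_le_of_range ((F n).covY (P n)) _ k₀ (F n).A (fun k hk =>
      ⟨_, (F n).covY_eq (h1 n) (h2 n) (Finset.mem_Icc.1 hk).1⟩) hj.1).trans ?_
    rw [mul_assoc, ← nsmul_eq_mul]
    exact (Finset.sum_le_card_nsmul _ _ _ hall).trans
      (le_of_eq (by rw [Nat.card_Icc, add_tsub_cancel_right]))
  · have hlo := ((isLittleO_one_iff ℝ).2 hh).mul_isBigO
      (isBigO_refl (fun n : ℕ => (p n : ℝ) ^ (2 - δ) * (n : ℝ) ^ (-(1 / 2) : ℝ)) atTop)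
    refine hlo.congr' ?_ (by simp only [one_mul]; rfl)
    filter_upwards [hpos] with n hn
    exact (sq_mul_inv_eq_mul_rpow hn.1 hn.2 δ).symm
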